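/- Let $N\ge 1$, $0<s<1$, and let $V:\mathbb R^N\to\mathbb R$ satisfy (V1) $V$ is continuous and $V\ge 0$ on $\mathbb R^N$; (V2) there is $b>0$ such that $\{x\in\mathbb R^N : V(x)<b\}$ is nonempty and has finite Lebesgue measure; (V3) $\Omega:=\operatorname{int}V^{-1}(0)$ is nonempty, has smooth boundary, and $\overline\Omega=V^{-1}(0)$. Let $f:\mathbb R^N\times\mathbb R\to\mathbb R$, write $F(x,u)=\int_0^u f(x,t)\,dt$, and assume (f1) $f$ is continuous, and there are $1<p<2$ and $\xi\in L^{2/(2-p)}(\mathbb R^N)$ such that $|f(x,u)|\le \xi(x)|u|^{p-1}$ for a.e. $x\in\mathbb R^N$ and all $u\in\mathbb R$; (f2) there are $\eta,\delta>0$ and $\gamma\in(1,2)$ such that $|F(x,u)|\ge\eta|u|^\gamma$ for all $x\in\Omega$ and $|u|\le\delta$. Let $E$ be the set of real-valued $u\in H^s(\mathbb R^N)$ with $\int_{\mathbb R^N}V u^2\,dx<\infty$, and for $\lambda>0$ and $u\in E$ put $$J_\lambda(u)=\frac12\int_{\mathbb R^N}|(-\Delta)^{s/2}u|^2\,dx+\frac\lambda2\int_{\mathbb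 R^N}V(x)u^2\,dx-\int_{\mathbb R^N}F(x,u)\,dx .$$ Then there is $\Lambda_0>0$ such that for every $\lambda>\Lambda_0$ the equation $$(-\Delta)^su+\lambda V(x)u=f(x,u)\quad\text{in }\mathbb R^N$$ has a weak solution $u_\lambda\in E\subset H^s(\mathbb R^N)$, that is, $$\int_{\mathbb R^N}(-\Delta)^{s/2}u_\lambda\,(-\Delta)^{s/2}v\,dx+\lambda\int_{\mathbb R^N}V u_\lambda v\,dx=\int_{\mathbb R^N}f(x,u_\lambda)v\,dx\quad\text{for all }v\in E,$$ which is a global minimizer of the energy, $J_\lambda(u_\lambda)=\min_{E}J_\lambda$. If moreover $F(x_0,u_0)>0$ for some $x_0\in\Omega$ and $|u_0|\le\delta$ (in particular if $F(x,u)\ge\eta|u|^\gamma$ for all $x\in\Omega$ and $|u|\le\delta$), then $J_\lambda(u_\lambda)<0$ and $u_\lambda\ne0$. -/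

import Mathlib

open MeasureTheory
open scoped FourierTransform ContDiff ComplexConjugate

noncomputable section

namespace FracSchrodinger

/-- The Euclidean space `ℝ^N`. -/
abbrev Space (N : ℕ) : Type := EuclideanSpace ℝ (Fin N)

/-- The real Hilbert space `L²(ℝ^N)` (functions modulo equality almost everywhere). -/
abbrev L2 (N : ℕ) : Type := Lp ℝ 2 (volume : Measure (Space N))

/-- The `L²` Fourier transform of a real function, in the normalization
`û(ζ) = ∫ e^{-2πi⟨x, ζ⟩} u(x) dx`. -/
def fourierL2 {N : ℕ} (u : L2 N) : Lp ℂ 2 (volume : Measure (Space N)) :=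
  𝓕 (Complex.ofRealCLM.compLp u)

/-- The Fourier transform of `(-Δ)^{s/2} u`, that is `|2πζ|^s û(ζ)`. The factor `2π` is the one
that belongs to the above normalization of the Fourier transform, so that `s = 2` would give
the Fourier transform of `-Δ u`. -/
def fourierHalfLap {N : ℕ} (s : ℝ) (u : L2 N) (ζ : Space N) : ℂ :=
  (((2 * Real.pi * ‖ζ‖) ^ s : ℝ) : ℂ) * fourierL2 u ζ

/-- `u ∈ H^s(ℝ^N)`: both `u` (by its type) and `(-Δ)^{s/2} u` are in `L²`. -/
def MemHs {N : ℕ} (s : ℝ) (u : L2 N) : Prop :=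
  MemLp (fourierHalfLap s u) 2 (volume : Measure (Space N))

/-- The form `∫ (-Δ)^{s/2} u (-Δ)^{s/2} v dx = ∫ |2πζ|^{2s} û(ζ) conj (v̂(ζ)) dζ` of the operator
`(-Δ)^s`, for real functions `u, v ∈ H^s`. -/
def fracForm {N : ℕ} (s : ℝ) (u v : L2 N) : ℝ :=
  ∫ ζ : Space N, (fourierHalfLap s u ζ * conj (fourierHalfLap s v ζ)).re

/-- The energy space: `u ∈ H^s(ℝ^N)` with `∫ V u² < ∞`. It is the same set for all `lam > 0`. -/
def MemEnergySpace {N : ℕ} (s : ℝ) (V : Space N → ℝ) (u : L2 N) : Prop :=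
  MemHs s u ∧ Integrable (fun x : Space N => V x * u x ^ 2)

/-- The primitive `F(x, t) = ∫₀ᵗ f(x, τ) dτ`. -/
def primitive {N : ℕ} (f : Space N → ℝ → ℝ) (x : Space N) (t : ℝ) : ℝ :=
  ∫ τ in (0 : ℝ)..t, f x τ

/-- The energy
`½ ∫ |(-Δ)^{s/2} u|² dx + (lam / 2) ∫ V u² dx - ∫ F(x, u) dx`. -/
def energy {N : ℕ} (s : ℝ) (V : Space N → ℝ) (f : Space N → ℝ → ℝ) (lam : ℝ) (u : L2 N) : ℝ :=
  1 / 2 * fracForm s u u + lam / 2 * (∫ x : Space N, V x * u x ^ 2)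
    - (∫ x : Space N, primitive f x (u x))

/-- `u` is a weak (energy) solution of `(-Δ)^s u + lam V(x) u = f(x, u)` in `ℝ^N`, `u ∈ H^s(ℝ^N)`.
The test functions run over the whole energy space (which contains `C_c^∞(ℝ^N)` when `V` is
continuous). -/
def IsWeakSolution {N : ℕ} (s : ℝ) (V : Space N → ℝ) (f : Space N → ℝ → ℝ) (lam : ℝ)
    (u : L2 N) : Prop :=
  MemEnergySpace s V u ∧
    ∀ v : L2 N, MemEnergySpace s V v →
      Integrable (fun x : Space N => f x (u x) * v x) ∧
      fracForm s u v + lam * (∫ x : Space N, V x * u x * v x)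
        = (∫ x : Space N, f x (u x) * v x)

/-- An open set `Ω` has smooth boundary: near each boundary point, `Ω` is the sublevel set
`{φ < 0}` of a smooth function `φ` with nonvanishing gradient. -/
def HasSmoothBoundary {N : ℕ} (Ω : Set (Space N)) : Prop :=
  ∀ x ∈ frontier Ω, ∃ U : Set (Space N), IsOpen U ∧ x ∈ U ∧
    ∃ φ : Space N → ℝ, ContDiffOn ℝ ∞ φ U ∧ (∀ y ∈ U, fderiv ℝ φ y ≠ 0) ∧
      Ω ∩ U = {y | y ∈ U ∧ φ y < 0}

/-- The set `Ω = int V⁻¹(0)`. -/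
def well {N : ℕ} (V : Space N → ℝ) : Set (Space N) := interior (V ⁻¹' {0})

/-- Steep well potentials. -/
structure IsSteepWell {N : ℕ} (V : Space N → ℝ) : Prop where
  continuous : Continuous V
  nonneg : ∀ x, 0 ≤ V x
  sublevel : ∃ b : ℝ, 0 < b ∧ {x | V x < b}.Nonempty ∧ volume {x | V x < b} < ⊤
  well_nonempty : (well V).Nonempty
  well_smooth : HasSmoothBoundary (well V)
  closure_well : closure (well V) = V ⁻¹' {0}

end FracSchrodinger

end

open Filter Topology
open scoped ENNReal NNReal

noncomputable section

namespace FracSchrodinger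

/-! ### Weak sequential compactness and weak lower semicontinuity -/

theorem exists_subseq_tendsto_dual {H : Type*} [NormedAddCommGroup H] [InnerProductSpace ℝ H]
    [CompleteSpace H] [TopologicalSpace.SeparableSpace H] {u : ℕ → H} {C : ℝ}
    (hu : ∀ n, ‖u n‖ ≤ C) :
    ∃ (a : H) (φ : ℕ → ℕ), StrictMono φ ∧
      ∀ ℓ : StrongDual ℝ H, Tendsto (fun n => ℓ (u (φ n))) atTop (𝓝 (ℓ a)) := by
  have hmem : ∀ n, StrongDual.toWeakDual (InnerProductSpace.toDual ℝ H (u n)) ∈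
      (WeakDual.toStrongDual ⁻¹' Metric.closedBall (0 : StrongDual ℝ H) C) := by
    intro n
    simpa using hu n
  obtain ⟨a, -, φ, hφ, h⟩ := WeakDual.isSeqCompact_closedBall ℝ H 0 C hmem
  refine ⟨(InnerProductSpace.toDual ℝ H).symm (WeakDual.toStrongDual a), φ, hφ, fun ℓ => ?_⟩
  have h1 := ((WeakDual.eval_continuous ((InnerProductSpace.toDual ℝ H).symm ℓ)).tendsto a).comp h
  have key : ∀ y : H, ℓ y = inner ℝ y ((InnerProductSpace.toDual ℝ H).symm ℓ) := by
    intro y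
    rw [real_inner_comm, InnerProductSpace.toDual_symm_apply]
  rw [key, InnerProductSpace.toDual_symm_apply]
  refine h1.congr fun n => ?_
  rw [key]
  rfl

section Weighted

variable {α : Type*} [MeasurableSpace α] {μ : Measure α} {𝕜 : Type*} [RCLike 𝕜]

theorem integrable_mul_norm_sq {w : α → ℝ} (hw : Measurable w) {k : ℝ} (hk : ∀ x, ‖w x‖ ≤ k)
    (u : Lp 𝕜 2 μ) : Integrable (fun x => w x * ‖u x‖ ^ 2) μ :=
  ((Lp.memLp u).integrable_norm_pow (by norm_num)).bdd_mul hw.aestronglyMeasurable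
    (Eventually.of_forall hk)

theorem lintegral_mul_enorm_sq_eq {w : α → ℝ} (hw : Measurable w) (hw0 : ∀ x, 0 ≤ w x)
    {k : ℝ} (hk : ∀ x, ‖w x‖ ≤ k) (u : Lp 𝕜 2 μ) :
    ∫⁻ x, ENNReal.ofReal (w x) * ‖u x‖ₑ ^ 2 ∂μ = ENNReal.ofReal (∫ x, w x * ‖u x‖ ^ 2 ∂μ) := by
  rw [ofReal_integral_eq_lintegral_ofReal (integrable_mul_norm_sq hw hk u)
    (Eventually.of_forall fun x => mul_nonneg (hw0 x) (sq_nonneg _))]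
  refine lintegral_congr fun x => ?_
  rw [ENNReal.ofReal_mul (hw0 x), ENNReal.ofReal_pow (norm_nonneg _), ofReal_norm]

theorem lintegral_mul_enorm_sq_le_liminf_of_bdd {w : α → ℝ} (hw : Measurable w)
    (hw0 : ∀ x, 0 ≤ w x) {k : ℝ} (hk : ∀ x, ‖w x‖ ≤ k) {u : Lp 𝕜 2 μ} {v : ℕ → Lp 𝕜 2 μ}
    (h : ∀ ℓ : StrongDual ℝ (Lp 𝕜 2 μ), Tendsto (fun n => ℓ (v n)) atTop (𝓝 (ℓ u))) :
    ∫⁻ x, ENNReal.ofReal (w x) * ‖u x‖ₑ ^ 2 ∂μ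
      ≤ liminf (fun n => ∫⁻ x, ENNReal.ofReal (w x) * ‖v n x‖ₑ ^ 2 ∂μ) atTop := by
  have hmem : MemLp (fun x => ((w x : ℝ) : 𝕜) * u x) 2 μ := by
    refine MemLp.of_le_mul (c := k) (Lp.memLp u)
      ((RCLike.measurable_ofReal.comp hw).aestronglyMeasurable.mul (Lp.aestronglyMeasurable u))
      (Eventually.of_forall fun x => ?_)
    rw [norm_mul, RCLike.norm_ofReal]
    exact mul_le_mul_of_nonneg_right (hk x) (norm_nonneg _)
  set ℓ : StrongDual ℝ (Lp 𝕜 2 μ) :=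
    RCLike.reCLM.comp ((innerSL 𝕜 (hmem.toLp _)).restrictScalars ℝ) with hℓ
  have hval : ∀ y : Lp 𝕜 2 μ, ℓ y = ∫ x, w x * RCLike.re (conj (u x) * y x) ∂μ := by
    intro y
    have : ℓ y = RCLike.re (inner 𝕜 (hmem.toLp _) y) := rfl
    rw [this, L2.inner_def, ← integral_re (L2.integrable_inner _ _)]
    refine integral_congr_ae ?_
    filter_upwards [hmem.coeFn_toLp] with x hx
    rw [hx]
    simp only [RCLike.inner_apply, map_mul, RCLike.conj_ofReal]
    rw [show y x * (((w x : ℝ) : 𝕜) * conj (u x)) = ((w x : ℝ) : 𝕜) * (conj (u x) * y x) by ring,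
      RCLike.re_ofReal_mul]
  have hint : ∀ y : Lp 𝕜 2 μ, Integrable (fun x => w x * RCLike.re (conj (u x) * y x)) μ := by
    intro y
    refine Integrable.bdd_mul ?_ hw.aestronglyMeasurable (Eventually.of_forall hk)
    have := (L2.integrable_inner (𝕜 := 𝕜) u y).re
    refine this.congr (Eventually.of_forall fun x => ?_)
    simp [RCLike.inner_apply, mul_comm]
  have hu : ℓ u = ∫ x, w x * ‖u x‖ ^ 2 ∂μ := by
    rw [hval]
    refine integral_congr_ae (Eventually.of_forall fun x => ?_)
    simp only [RCLike.conj_mul]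
    norm_cast
  have hlow : ∀ n, ENNReal.ofReal (2 * ℓ (v n) - ∫ x, w x * ‖u x‖ ^ 2 ∂μ)
      ≤ ∫⁻ x, ENNReal.ofReal (w x) * ‖v n x‖ₑ ^ 2 ∂μ := by
    intro n
    rw [lintegral_mul_enorm_sq_eq hw hw0 hk]
    refine ENNReal.ofReal_le_ofReal ?_
    rw [hval, ← integral_const_mul, ← integral_sub ((hint _).const_mul 2)
      (integrable_mul_norm_sq hw hk u)]
    refine integral_mono (((hint _).const_mul 2).sub (integrable_mul_norm_sq hw hk u))
      (integrable_mul_norm_sq hw hk _) fun x => ?_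
    have h1 : RCLike.re (conj (u x) * v n x) ≤ ‖u x‖ * ‖v n x‖ := by
      refine (RCLike.re_le_norm _).trans ?_
      rw [norm_mul, RCLike.norm_conj]
    have h2 : 2 * RCLike.re (conj (u x) * v n x) - ‖u x‖ ^ 2 ≤ ‖v n x‖ ^ 2 := by
      nlinarith [sq_nonneg (‖u x‖ - ‖v n x‖)]
    have := mul_le_mul_of_nonneg_left h2 (hw0 x)
    simp only
    linarith
  have hlim : Tendsto (fun n => ENNReal.ofReal (2 * ℓ (v n) - ∫ x, w x * ‖u x‖ ^ 2 ∂μ)) atTop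
      (𝓝 (∫⁻ x, ENNReal.ofReal (w x) * ‖u x‖ₑ ^ 2 ∂μ)) := by
    rw [lintegral_mul_enorm_sq_eq hw hw0 hk]
    refine (ENNReal.continuous_ofReal.tendsto _).comp ?_
    have := ((h ℓ).const_mul 2).sub_const (∫ x, w x * ‖u x‖ ^ 2 ∂μ)
    rw [hu] at this
    convert! this using 2
    ring
  rw [← hlim.liminf_eq]
  exact liminf_le_liminf (Eventually.of_forall hlow)

/-- Weighted `L²` seminorms are weakly sequentially lower semicontinuous. -/
theorem lintegral_mul_enorm_sq_le_liminf {w : α → ℝ} (hw : Measurable w)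
    (hw0 : ∀ x, 0 ≤ w x) {u : Lp 𝕜 2 μ} {v : ℕ → Lp 𝕜 2 μ}
    (h : ∀ ℓ : StrongDual ℝ (Lp 𝕜 2 μ), Tendsto (fun n => ℓ (v n)) atTop (𝓝 (ℓ u))) :
    ∫⁻ x, ENNReal.ofReal (w x) * ‖u x‖ₑ ^ 2 ∂μ
      ≤ liminf (fun n => ∫⁻ x, ENNReal.ofReal (w x) * ‖v n x‖ₑ ^ 2 ∂μ) atTop := by
  have hsup : ∀ x, ENNReal.ofReal (w x) * ‖u x‖ₑ ^ 2
      = ⨆ k : ℕ, ENNReal.ofReal (min (w x) k) * ‖u x‖ₑ ^ 2 := by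
    intro x
    rw [← ENNReal.iSup_mul]
    congr 1
    refine le_antisymm ?_ (iSup_le fun k => ENNReal.ofReal_le_ofReal (min_le_left _ _))
    obtain ⟨k, hk⟩ := exists_nat_ge (w x)
    refine le_iSup_of_le k ?_
    rw [min_eq_left hk]
  have hu : AEMeasurable (fun x => ‖u x‖ₑ ^ 2) μ := (Lp.aestronglyMeasurable u).enorm.pow_const 2
  simp_rw [hsup]
  rw [lintegral_iSup' (f := fun (k : ℕ) x => ENNReal.ofReal (min (w x) k) * ‖u x‖ₑ ^ 2)
    (fun k => ((hw.min measurable_const).ennreal_ofReal.aemeasurable.mul hu))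
    (Eventually.of_forall fun x j k hjk => by
      simp only
      gcongr)]
  refine iSup_le fun k => ?_
  refine (lintegral_mul_enorm_sq_le_liminf_of_bdd (k := (k : ℝ)) (hw.min measurable_const)
    (fun x => le_min (hw0 x) (Nat.cast_nonneg k)) (fun x => ?_) h).trans ?_
  · rw [Real.norm_of_nonneg (le_min (hw0 x) (Nat.cast_nonneg k))]
    exact min_le_right _ _
  · refine liminf_le_liminf (Eventually.of_forall fun n => lintegral_mono fun x => ?_)
    gcongr
    exact min_le_left _ _

end Weighted

/-! ### The Fourier transform on `L²` and its low frequency part -/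

section LpTwo

variable {α : Type*} [MeasurableSpace α] {μ : Measure α} {E : Type*} [NormedAddCommGroup E]

theorem lintegral_enorm_sq (g : Lp E 2 μ) : ∫⁻ x, ‖g x‖ₑ ^ 2 ∂μ = ‖g‖ₑ ^ 2 := by
  rw [Lp.enorm_def, eLpNorm_eq_lintegral_rpow_enorm_toReal (by norm_num) (by norm_num),
    ← ENNReal.rpow_natCast, ← ENNReal.rpow_mul]
  simp

theorem enorm_add_sq_le (a b : E) : ‖a + b‖ₑ ^ 2 ≤ 2 * ‖a‖ₑ ^ 2 + 2 * ‖b‖ₑ ^ 2 := by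
  have h := ENNReal.rpow_add_le_mul_rpow_add_rpow ‖a‖ₑ ‖b‖ₑ (p := 2) (by norm_num)
  norm_num at h
  refine (pow_le_pow_left' (enorm_add_le a b) 2).trans ?_
  rwa [mul_add] at h

end LpTwo

variable {N : ℕ}

theorem continuous_fourierInv {g : Space N → ℂ} (hg : Integrable g) : Continuous (𝓕⁻ g) := by
  have h := VectorFourier.fourierIntegral_continuous (μ := (volume : Measure (Space N)))
    (L := innerₗ (Space N)) Real.continuous_fourierChar continuous_inner hg
  have : 𝓕⁻ g = fun x => 𝓕 g (-x) := funext fun x => Real.fourierInv_eq_fourier_neg _ _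
  rw [this]
  exact h.comp continuous_neg

theorem fourierInv_ae_eq_of_integrable (g : Lp ℂ 2 (volume : Measure (Space N)))
    (hg : Integrable g) :
    ∀ᵐ x, (𝓕⁻ g : Lp ℂ 2 (volume : Measure (Space N))) x = 𝓕⁻ (g : Space N → ℂ) x := by
  refine ae_eq_of_integral_contDiff_smul_eq
    ((Lp.memLp _).locallyIntegrable (by norm_num)) (continuous_fourierInv hg).locallyIntegrable
    fun φ hφ hφc => ?_
  have hc₁ : HasCompactSupport (Complex.ofRealCLM ∘ φ) := hφc.comp_left rfl
  have hc₂ : ContDiff ℝ ∞ (Complex.ofRealCLM ∘ φ) := by fun_prop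
  set ψ : SchwartzMap (Space N) ℂ := hc₁.toSchwartzMap hc₂ with hψ
  have hψv : ∀ x, ψ x = (φ x : ℂ) := fun x => rfl
  have h1 := Lp.fourierInv_toTemperedDistribution_eq g
  have h2 := DFunLike.congr_fun h1 ψ
  rw [TemperedDistribution.fourierInv_apply, Lp.toTemperedDistribution_apply,
    Lp.toTemperedDistribution_apply] at h2
  have h3 : ∫ x, 𝓕⁻ ψ x • g x = ∫ x, ψ x • 𝓕⁻ (g : Space N → ℂ) x := by
    have h4 := VectorFourier.integral_fourierIntegral_smul_eq_flip
      (μ := (volume : Measure (Space N))) (ν := (volume : Measure (Space N)))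
      (L := -innerₗ (Space N)) Real.continuous_fourierChar
      (continuous_inner (𝕜 := ℝ) (E := Space N)).neg ψ.integrable hg
    have hflip : (-innerₗ (Space N)).flip = -innerₗ (Space N) := by
      ext x y
      simp [real_inner_comm]
    rw [hflip] at h4
    rw [SchwartzMap.fourierInv_coe]
    exact h4
  rw [h3] at h2
  simp only [hψv] at h2
  simpa using h2.symm

/-- The `L²` Fourier transform of real functions, as a continuous linear map. -/
def fourierCLM (N : ℕ) : L2 N →L[ℝ] Lp ℂ 2 (volume : Measure (Space N)) :=
  ((Lp.fourierTransformₗᵢ (Space N) ℂ).toContinuousLinearEquiv.toContinuousLinearMap.restrictScalars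
    ℝ).comp (Complex.ofRealCLM.compLpL 2 volume)

theorem norm_compLp_ofReal (u : L2 N) : ‖Complex.ofRealCLM.compLp u‖ = ‖u‖ := by
  rw [Lp.norm_def, Lp.norm_def]
  congr 1
  refine eLpNorm_congr_norm_ae ?_
  filter_upwards [Complex.ofRealCLM.coeFn_compLp u] with x hx
  rw [hx]
  simp

theorem norm_fourierL2 (u : L2 N) : ‖fourierL2 u‖ = ‖u‖ := by
  rw [fourierL2, Lp.norm_fourier_eq, norm_compLp_ofReal]

theorem fourierInv_fourierL2 (u : L2 N) :
    𝓕⁻ (fourierL2 u) = Complex.ofRealCLM.compLp u :=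
  FourierTransform.fourierInv_fourier_eq _

theorem memLp_planeWave (R : ℝ) (x : Space N) :
    MemLp ((Metric.ball (0 : Space N) R).indicator
      fun ζ => ((Real.fourierChar (-inner ℝ ζ x) : Circle) : ℂ)) 2 volume := by
  refine MemLp.of_le (g := (Metric.ball (0 : Space N) R).indicator fun _ => (1 : ℂ))
    (memLp_indicator_const 2 measurableSet_ball 1 (Or.inr measure_ball_lt_top.ne)) ?_ ?_
  · refine (Continuous.aestronglyMeasurable ?_).indicator measurableSet_ball
    fun_prop
  · refine Eventually.of_forall fun ζ => ?_
    rw [norm_indicator_eq_indicator_norm, norm_indicator_eq_indicator_norm]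
    simp only [Circle.norm_coe, norm_one, le_refl]

/-- The plane wave `ζ ↦ e^{-2πi⟨ζ, x⟩}` cut off to the ball of radius `R`. -/
def planeWave (R : ℝ) (x : Space N) : Lp ℂ 2 (volume : Measure (Space N)) :=
  (memLp_planeWave R x).toLp _

theorem enorm_planeWave_sq (R : ℝ) (x : Space N) :
    ‖planeWave R x‖ₑ ^ 2 = volume (Metric.ball (0 : Space N) R) := by
  rw [← lintegral_enorm_sq, ← lintegral_indicator_one measurableSet_ball]
  refine lintegral_congr_ae ?_
  filter_upwards [(memLp_planeWave R x).coeFn_toLp] with ζ hζ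
  rw [planeWave, hζ]
  by_cases h : ζ ∈ Metric.ball (0 : Space N) R
  · rw [Set.indicator_of_mem h, Set.indicator_of_mem h, ← ofReal_norm, Circle.norm_coe]
    simp
  · rw [Set.indicator_of_notMem h, Set.indicator_of_notMem h]
    simp

theorem inner_planeWave (R : ℝ) (x : Space N) (g : Lp ℂ 2 (volume : Measure (Space N))) :
    inner ℂ (planeWave R x) g = 𝓕⁻ ((Metric.ball (0 : Space N) R).indicator g) x := by
  rw [L2.inner_def, Real.fourierInv_eq]
  refine integral_congr_ae ?_
  filter_upwards [(memLp_planeWave R x).coeFn_toLp] with ζ hζ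
  rw [planeWave, hζ]
  by_cases h : ζ ∈ Metric.ball (0 : Space N) R
  · rw [Set.indicator_of_mem h, Set.indicator_of_mem h, RCLike.inner_apply, Circle.smul_def,
      AddChar.map_neg_eq_inv, Circle.coe_inv_eq_conj, RCLike.conj_conj]
    simp [mul_comm]
  · rw [Set.indicator_of_notMem h, Set.indicator_of_notMem h]
    simp

theorem integrable_indicator_ball (g : Lp ℂ 2 (volume : Measure (Space N))) (R : ℝ) :
    Integrable ((Metric.ball (0 : Space N) R).indicator g) := by
  rw [integrable_indicator_iff measurableSet_ball]
  have : IsFiniteMeasure (volume.restrict (Metric.ball (0 : Space N) R)) :=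
    ⟨by simpa using measure_ball_lt_top⟩
  exact (((Lp.memLp g).mono_measure Measure.restrict_le_self).mono_exponent
    (p := 1) (by norm_num)).integrable le_rfl

/-- The value at `x` of the part of `u` with frequencies `‖ζ‖ < R`. -/
def lowPass (R : ℝ) (x : Space N) : L2 N →L[ℝ] ℂ :=
  ((innerSL ℂ (planeWave R x)).restrictScalars ℝ).comp (fourierCLM N)

theorem lowPass_apply (R : ℝ) (x : Space N) (u : L2 N) :
    lowPass R x u = inner ℂ (planeWave R x) (fourierL2 u) := rfl

theorem continuous_lowPass (R : ℝ) (u : L2 N) : Continuous fun x => lowPass R x u := by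
  simp_rw [lowPass_apply, inner_planeWave]
  exact continuous_fourierInv (integrable_indicator_ball _ R)

theorem enorm_lowPass_sq_le (R : ℝ) (x : Space N) (u : L2 N) :
    ‖lowPass R x u‖ₑ ^ 2 ≤ volume (Metric.ball (0 : Space N) R) * ‖u‖ₑ ^ 2 := by
  have h : ‖lowPass R x u‖ₑ ≤ ‖planeWave R x‖ₑ * ‖u‖ₑ := by
    rw [← ofReal_norm, ← ofReal_norm, ← ofReal_norm, ← ENNReal.ofReal_mul (norm_nonneg _),
      ← norm_fourierL2 u]
    refine ENNReal.ofReal_le_ofReal ?_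
    simpa [lowPass_apply] using norm_inner_le_norm (𝕜 := ℂ) (planeWave R x) (fourierL2 u)
  rw [← enorm_planeWave_sq R x, ← mul_pow]
  exact pow_le_pow_left' h 2

/-- The square of the `L²` norm of `(-Δ)^{s/2} u`, possibly infinite. -/
def fracEnergy (s : ℝ) (u : L2 N) : ℝ≥0∞ := ∫⁻ ζ, ‖fourierHalfLap s u ζ‖ₑ ^ 2

theorem enorm_fourierHalfLap_sq (s : ℝ) (u : L2 N) (ζ : Space N) :
    ‖fourierHalfLap s u ζ‖ₑ ^ 2
      = ENNReal.ofReal (((2 * Real.pi * ‖ζ‖) ^ s) ^ 2) * ‖fourierL2 u ζ‖ₑ ^ 2 := by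
  have h0 : 0 ≤ (2 * Real.pi * ‖ζ‖) ^ s := by positivity
  rw [fourierHalfLap, enorm_mul, mul_pow, ENNReal.ofReal_pow h0]
  congr 2
  rw [← ofReal_norm, Complex.norm_real, Real.norm_of_nonneg h0]

/-- On any set, a function in `H^s` is controlled by its low frequencies. -/
theorem setLIntegral_enorm_sq_le {s : ℝ} (hs : 0 < s) {R : ℝ} (hR : 0 < R) (u : L2 N)
    (A : Set (Space N)) :
    ∫⁻ x in A, ‖u x‖ₑ ^ 2 ≤ 2 * (∫⁻ x in A, ‖lowPass R x u‖ₑ ^ 2)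
      + 2 * (ENNReal.ofReal (((2 * Real.pi * R) ^ s) ^ 2)⁻¹ * fracEnergy s u) := by
  set B := Metric.ball (0 : Space N) R with hB
  have m1 : MemLp (B.indicator (fourierL2 u)) 2 volume := (Lp.memLp _).indicator measurableSet_ball
  have m2 : MemLp (Bᶜ.indicator (fourierL2 u)) 2 volume :=
    (Lp.memLp _).indicator measurableSet_ball.compl
  have hsum : fourierL2 u = m1.toLp _ + m2.toLp _ := by
    ext1
    filter_upwards [m1.coeFn_toLp, m2.coeFn_toLp, Lp.coeFn_add (m1.toLp _) (m2.toLp _)]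
      with x h1 h2 h3
    rw [h3, Pi.add_apply, h1, h2, Set.indicator_self_add_compl_apply]
  have hsum' : Complex.ofRealCLM.compLp u = 𝓕⁻ (m1.toLp _) + 𝓕⁻ (m2.toLp _) := by
    rw [← fourierInv_fourierL2, ← FourierTransform.fourierInv_add, ← hsum]
  have hint : Integrable (m1.toLp _) := by
    rw [integrable_congr m1.coeFn_toLp]
    exact integrable_indicator_ball _ R
  have hlow : ∀ᵐ x, (𝓕⁻ (m1.toLp _) : Lp ℂ 2 (volume : Measure (Space N))) x = lowPass R x u := by
    filter_upwards [fourierInv_ae_eq_of_integrable _ hint] with x hx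
    rw [hx, lowPass_apply, inner_planeWave]
    refine Real.fourierInv_congr_ae m1.coeFn_toLp x
  have hpt : ∀ᵐ x, ‖u x‖ₑ ^ 2 ≤ 2 * ‖lowPass R x u‖ₑ ^ 2
      + 2 * ‖(𝓕⁻ (m2.toLp _) : Lp ℂ 2 (volume : Measure (Space N))) x‖ₑ ^ 2 := by
    filter_upwards [hlow, Complex.ofRealCLM.coeFn_compLp u,
      Lp.coeFn_add (𝓕⁻ (m1.toLp _)) (𝓕⁻ (m2.toLp _))] with x h1 h2 h3
    rw [hsum', h3, Pi.add_apply, h1] at h2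
    refine le_trans (le_of_eq ?_) (enorm_add_sq_le _ _)
    rw [h2, ← ofReal_norm, ← ofReal_norm]
    simp
  have hhigh : ∫⁻ x, ‖(𝓕⁻ (m2.toLp _) : Lp ℂ 2 (volume : Measure (Space N))) x‖ₑ ^ 2
      ≤ ENNReal.ofReal (((2 * Real.pi * R) ^ s) ^ 2)⁻¹ * fracEnergy s u := by
    have hn : ‖(𝓕⁻ (m2.toLp _) : Lp ℂ 2 (volume : Measure (Space N)))‖ₑ = ‖m2.toLp _‖ₑ := by
      rw [← ofReal_norm, ← ofReal_norm]
      congr 1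
      exact (Lp.fourierTransformₗᵢ (Space N) ℂ).symm.norm_map _
    rw [lintegral_enorm_sq, hn, ← lintegral_enorm_sq, fracEnergy,
      ← lintegral_const_mul' _ _ ENNReal.ofReal_ne_top]
    refine lintegral_mono_ae ?_
    filter_upwards [m2.coeFn_toLp] with ζ hζ
    rw [hζ, enorm_fourierHalfLap_sq, ← mul_assoc]
    by_cases h : ζ ∈ B
    · rw [Set.indicator_of_notMem (by simpa using h)]
      simp
    · rw [Set.indicator_of_mem (by simpa using h), ← ENNReal.ofReal_mul (by positivity)]
      refine le_mul_of_one_le_left' ?_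
      rw [ENNReal.one_le_ofReal]
      have hζR : R ≤ ‖ζ‖ := by simpa [hB] using h
      rw [← div_eq_inv_mul, one_le_div (by positivity)]
      gcongr
  calc ∫⁻ x in A, ‖u x‖ₑ ^ 2
      ≤ ∫⁻ x in A, (2 * ‖lowPass R x u‖ₑ ^ 2
        + 2 * ‖(𝓕⁻ (m2.toLp _) : Lp ℂ 2 (volume : Measure (Space N))) x‖ₑ ^ 2) :=
        lintegral_mono_ae (ae_restrict_of_ae hpt)
    _ = 2 * (∫⁻ x in A, ‖lowPass R x u‖ₑ ^ 2)
        + 2 * ∫⁻ x in A, ‖(𝓕⁻ (m2.toLp _) : Lp ℂ 2 (volume : Measure (Space N))) x‖ₑ ^ 2 := by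
        rw [lintegral_add_right', lintegral_const_mul' _ _ (by norm_num),
          lintegral_const_mul' _ _ (by norm_num)]
        exact (((Lp.aestronglyMeasurable _).enorm.pow_const 2).const_mul 2).restrict
    _ ≤ _ := by
        gcongr
        exact (lintegral_mono' Measure.restrict_le_self le_rfl).trans hhigh

/-! ### Coercivity and local compactness in `H^s` -/

theorem fourierHalfLap_add (s : ℝ) (u v : L2 N) :
    fourierHalfLap s (u + v) =ᵐ[volume] fourierHalfLap s u + fourierHalfLap s v := by
  have h : fourierL2 (u + v) = fourierL2 u + fourierL2 v := (fourierCLM N).map_add u v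
  filter_upwards [Lp.coeFn_add (fourierL2 u) (fourierL2 v)] with ζ hζ
  simp only [fourierHalfLap, h, hζ, Pi.add_apply, mul_add]

theorem fourierHalfLap_smul (s c : ℝ) (u : L2 N) :
    fourierHalfLap s (c • u) =ᵐ[volume] c • fourierHalfLap s u := by
  have h : fourierL2 (c • u) = c • fourierL2 u := (fourierCLM N).map_smul c u
  filter_upwards [Lp.coeFn_smul c (fourierL2 u)] with ζ hζ
  simp only [fourierHalfLap, h, hζ, Pi.smul_apply, Complex.real_smul]
  ring

theorem measurable_symbol (s : ℝ) : Measurable fun ζ : Space N => (2 * Real.pi * ‖ζ‖) ^ s :=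
  ((measurable_norm.const_mul _)).pow_const s

theorem aestronglyMeasurable_fourierHalfLap (s : ℝ) (u : L2 N) :
    AEStronglyMeasurable (fourierHalfLap s u) volume :=
  (Complex.measurable_ofReal.comp (measurable_symbol s)).aestronglyMeasurable.mul
    (Lp.aestronglyMeasurable _)

theorem fracEnergy_sub_le (s : ℝ) (u v : L2 N) :
    fracEnergy s (u - v) ≤ 2 * fracEnergy s u + 2 * fracEnergy s v := by
  have hm : ∀ w : L2 N, AEMeasurable (fun ζ => 2 * ‖fourierHalfLap s w ζ‖ₑ ^ 2) volume := fun w =>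
    ((aestronglyMeasurable_fourierHalfLap s w).enorm.pow_const 2).const_mul 2
  rw [fracEnergy, fracEnergy, fracEnergy, ← lintegral_const_mul' _ _ (by norm_num),
    ← lintegral_const_mul' _ _ (by norm_num), ← lintegral_add_left' (hm u)]
  refine lintegral_mono_ae ?_
  have h : u - v = u + (-1 : ℝ) • v := by rw [neg_one_smul, sub_eq_add_neg]
  rw [h]
  filter_upwards [fourierHalfLap_add s u ((-1 : ℝ) • v), fourierHalfLap_smul s (-1) v]
    with ζ h1 h2
  rw [h1, Pi.add_apply, h2]
  refine (enorm_add_sq_le _ _).trans (le_of_eq ?_)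
  simp

theorem fracEnergy_le_liminf (s : ℝ) {u : L2 N} {v : ℕ → L2 N}
    (h : ∀ ℓ : StrongDual ℝ (L2 N), Tendsto (fun n => ℓ (v n)) atTop (𝓝 (ℓ u))) :
    fracEnergy s u ≤ liminf (fun n => fracEnergy s (v n)) atTop := by
  simp_rw [fracEnergy, enorm_fourierHalfLap_sq]
  exact lintegral_mul_enorm_sq_le_liminf ((measurable_symbol s).pow_const 2)
    (fun ζ => sq_nonneg _) fun ℓ => h (ℓ.comp (fourierCLM N))

/-- The quadratic form `∫ |(-Δ)^{s/2} u|² + ∫ W u²`, possibly infinite. -/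
def quadEnergy (s : ℝ) (W : Space N → ℝ) (u : L2 N) : ℝ≥0∞ :=
  fracEnergy s u + ∫⁻ x, ENNReal.ofReal (W x) * ‖u x‖ₑ ^ 2

theorem quadEnergy_le_liminf (s : ℝ) {W : Space N → ℝ} (hW : Measurable W) (hW0 : ∀ x, 0 ≤ W x)
    {u : L2 N} {v : ℕ → L2 N}
    (h : ∀ ℓ : StrongDual ℝ (L2 N), Tendsto (fun n => ℓ (v n)) atTop (𝓝 (ℓ u))) :
    quadEnergy s W u ≤ liminf (fun n => quadEnergy s W (v n)) atTop := by
  have h1 := fracEnergy_le_liminf s h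
  have h2 := lintegral_mul_enorm_sq_le_liminf hW hW0 h
  refine (add_le_add h1 h2).trans ?_
  simp only [liminf_eq_iSup_iInf_of_nat]
  rw [ENNReal.iSup_add_iSup_of_monotone]
  · refine iSup_mono fun n => le_iInf₂ fun i hi => ?_
    exact add_le_add (iInf₂_le i hi) (iInf₂_le i hi)
  · exact fun m n hmn => le_iInf₂ fun i hi => iInf₂_le i (hmn.trans hi)
  · exact fun m n hmn => le_iInf₂ fun i hi => iInf₂_le i (hmn.trans hi)

theorem exists_volume_ball_mul_le (hN : 1 ≤ N) {a : ℝ≥0∞} (ha : a ≠ ⊤) {ε : ℝ≥0∞} (hε : 0 < ε) :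
    ∃ R : ℝ, 0 < R ∧ a * volume (Metric.ball (0 : Space N) R) ≤ ε := by
  have hlim : Tendsto (fun R : ℝ => a * (ENNReal.ofReal (R ^ N)
      * volume (Metric.ball (0 : Space N) 1))) (𝓝[>] 0) (𝓝 0) := by
    have h1 : Tendsto (fun R : ℝ => R ^ N) (𝓝[>] 0) (𝓝 0) := by
      have : Tendsto (fun R : ℝ => R ^ N) (𝓝 0) (𝓝 (0 ^ N)) := (continuous_pow N).tendsto 0
      rw [zero_pow (by omega)] at this
      exact this.mono_left nhdsWithin_le_nhds
    have h2 := (ENNReal.continuous_ofReal.tendsto 0).comp h1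
    rw [ENNReal.ofReal_zero] at h2
    have h3 := ENNReal.Tendsto.const_mul (a := a) (ENNReal.Tendsto.mul_const
      (b := volume (Metric.ball (0 : Space N) 1)) h2 (Or.inr measure_ball_lt_top.ne)) (Or.inr ha)
    simpa using h3
  have hev := (hlim.eventually (gt_mem_nhds hε)).and self_mem_nhdsWithin
  obtain ⟨R, hR, hR0⟩ := hev.exists
  refine ⟨R, hR0, ?_⟩
  rw [Measure.addHaar_ball_of_pos _ _ hR0]
  simpa using hR.le

theorem enorm_sq_le_mul_quadEnergy (hN : 1 ≤ N) {s : ℝ} (hs : 0 < s) {W : Space N → ℝ}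
    (hW : Measurable W) {b : ℝ} (hb : 0 < b) (hvol : volume {x | W x < b} < ⊤) :
    ∃ K : ℝ≥0∞, K ≠ ⊤ ∧ ∀ u : L2 N, ‖u‖ₑ ^ 2 ≤ K * quadEnergy s W u := by
  set A := {x | W x < b} with hA
  have hAm : MeasurableSet A := measurableSet_lt hW measurable_const
  obtain ⟨R, hR, hRA⟩ := exists_volume_ball_mul_le hN (a := 2 * volume A)
    (ENNReal.mul_ne_top (by norm_num) hvol.ne) (ε := 2⁻¹) (by norm_num)
  set c := ENNReal.ofReal (((2 * Real.pi * R) ^ s) ^ 2)⁻¹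
  have hbt : (ENNReal.ofReal b)⁻¹ ≠ ⊤ := by simpa using hb
  refine ⟨2 * (2 * c + (ENNReal.ofReal b)⁻¹), ENNReal.mul_ne_top (by norm_num)
    (ENNReal.add_ne_top.2 ⟨ENNReal.mul_ne_top (by norm_num) ENNReal.ofReal_ne_top, hbt⟩),
    fun u => ?_⟩
  set P := ∫⁻ x, ENNReal.ofReal (W x) * ‖u x‖ₑ ^ 2 with hP
  have h1 : ∫⁻ x in Aᶜ, ‖u x‖ₑ ^ 2 ≤ (ENNReal.ofReal b)⁻¹ * P := by
    rw [hP, ← lintegral_const_mul' _ _ hbt, ← lintegral_indicator hAm.compl]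
    refine lintegral_mono fun x => ?_
    by_cases hx : x ∈ A
    · simp [hx]
    · rw [Set.indicator_of_mem (by simpa using hx), ← mul_assoc]
      refine le_mul_of_one_le_left' ?_
      have hWx : b ≤ W x := by simpa [hA] using hx
      rw [← ENNReal.mul_inv_cancel (a := ENNReal.ofReal b) (by simpa using hb)
        ENNReal.ofReal_ne_top, mul_comm]
      gcongr
  have h2 : ∫⁻ x in A, ‖u x‖ₑ ^ 2 ≤ 2⁻¹ * ‖u‖ₑ ^ 2 + 2 * (c * fracEnergy s u) := by
    refine (setLIntegral_enorm_sq_le hs hR u A).trans (add_le_add_left ?_ _)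
    calc 2 * ∫⁻ x in A, ‖lowPass R x u‖ₑ ^ 2
        ≤ 2 * ∫⁻ x in A, volume (Metric.ball (0 : Space N) R) * ‖u‖ₑ ^ 2 := by
          gcongr with x
          exact enorm_lowPass_sq_le R x u
      _ = (2 * volume A * volume (Metric.ball (0 : Space N) R)) * ‖u‖ₑ ^ 2 := by
          rw [setLIntegral_const]
          ring
      _ ≤ _ := by gcongr
  have h3 : ‖u‖ₑ ^ 2 ≤ 2⁻¹ * ‖u‖ₑ ^ 2 + (2 * c + (ENNReal.ofReal b)⁻¹) * quadEnergy s W u := by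
    calc ‖u‖ₑ ^ 2 = (∫⁻ x in A, ‖u x‖ₑ ^ 2) + ∫⁻ x in Aᶜ, ‖u x‖ₑ ^ 2 := by
          rw [lintegral_add_compl _ hAm, lintegral_enorm_sq]
      _ ≤ 2⁻¹ * ‖u‖ₑ ^ 2 + 2 * (c * fracEnergy s u) + (ENNReal.ofReal b)⁻¹ * P := add_le_add h2 h1
      _ ≤ 2⁻¹ * ‖u‖ₑ ^ 2 + (2 * c * quadEnergy s W u
          + (ENNReal.ofReal b)⁻¹ * quadEnergy s W u) := by
          rw [add_assoc, ← mul_assoc 2]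
          gcongr
          · exact le_self_add
          · exact le_add_self
      _ = _ := by rw [← add_mul]
  have hfin : 2⁻¹ * ‖u‖ₑ ^ 2 ≠ ⊤ := ENNReal.mul_ne_top (by norm_num) (by simp)
  have h4 : ‖u‖ₑ ^ 2 = 2⁻¹ * ‖u‖ₑ ^ 2 + 2⁻¹ * ‖u‖ₑ ^ 2 := by
    rw [← add_mul, ENNReal.inv_two_add_inv_two, one_mul]
  have h5 : 2⁻¹ * ‖u‖ₑ ^ 2 ≤ (2 * c + (ENNReal.ofReal b)⁻¹) * quadEnergy s W u := by
    rw [← ENNReal.add_le_add_iff_left hfin, ← h4]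
    exact h3
  rwa [mul_assoc 2, ← ENNReal.inv_mul_le_iff (by norm_num) (by norm_num)]

theorem tendsto_setLIntegral_sub_of_tendsto_dual {s : ℝ} (hs : 0 < s) {u : L2 N} {v : ℕ → L2 N}
    (h : ∀ ℓ : StrongDual ℝ (L2 N), Tendsto (fun n => ℓ (v n)) atTop (𝓝 (ℓ u)))
    {C : ℝ≥0∞} (hC : C ≠ ⊤) (hv : ∀ n, ‖v n‖ₑ ^ 2 ≤ C)
    {M : ℝ≥0∞} (hM : M ≠ ⊤) (hvM : ∀ n, fracEnergy s (v n) ≤ M)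
    {A : Set (Space N)} (hA : volume A ≠ ⊤) :
    Tendsto (fun n => ∫⁻ x in A, ‖(v n - u) x‖ₑ ^ 2) atTop (𝓝 0) := by
  have huM : fracEnergy s u ≤ M :=
    (fracEnergy_le_liminf s h).trans ((liminf_le_liminf (Eventually.of_forall hvM)).trans
      (by simp))
  have hd : ∀ n, fracEnergy s (v n - u) ≤ 4 * M := fun n =>
    (fracEnergy_sub_le s _ _).trans (by
      calc 2 * fracEnergy s (v n) + 2 * fracEnergy s u ≤ 2 * M + 2 * M := by
            gcongr
            exact hvM n
        _ = 4 * M := by ring)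
  rw [ENNReal.tendsto_nhds_zero]
  intro ε hε
  obtain ⟨R, hR, hRε⟩ : ∃ R : ℝ, 0 < R ∧
      2 * (ENNReal.ofReal (((2 * Real.pi * R) ^ s) ^ 2)⁻¹ * (4 * M)) ≤ ε / 2 := by
    have hlim : Tendsto (fun R : ℝ => 2 * (ENNReal.ofReal (((2 * Real.pi * R) ^ s) ^ 2)⁻¹
        * (4 * M))) atTop (𝓝 0) := by
      have h1 : Tendsto (fun R : ℝ => (((2 * Real.pi * R) ^ s) ^ 2)⁻¹) atTop (𝓝 0) := by
        refine tendsto_inv_atTop_zero.comp ((tendsto_pow_atTop (by norm_num)).comp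
          ((tendsto_rpow_atTop hs).comp ?_))
        exact tendsto_id.const_mul_atTop (by positivity)
      have h2 := (ENNReal.continuous_ofReal.tendsto 0).comp h1
      rw [ENNReal.ofReal_zero] at h2
      have h3 := ENNReal.Tendsto.const_mul (a := 2) (ENNReal.Tendsto.mul_const
        (b := 4 * M) h2 (Or.inr (ENNReal.mul_ne_top (by norm_num) hM))) (Or.inr (by norm_num))
      simpa using h3
    have hev := (hlim.eventually (gt_mem_nhds (ENNReal.half_pos hε.ne'))).and (eventually_gt_atTop 0)
    obtain ⟨R, hR, hR0⟩ := hev.exists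
    exact ⟨R, hR0, hR.le⟩
  have hlow : Tendsto (fun n => 2 * ∫⁻ x in A, ‖lowPass R x (v n - u)‖ₑ ^ 2) atTop (𝓝 0) := by
    have h0 : Tendsto (fun n => ∫⁻ x in A, ‖lowPass R x (v n - u)‖ₑ ^ 2) atTop
        (𝓝 (∫⁻ x in A, 0)) := by
      refine tendsto_lintegral_of_dominated_convergence
        (fun _ => volume (Metric.ball (0 : Space N) R) * (2 * C + 2 * ‖u‖ₑ ^ 2)) ?_ ?_ ?_ ?_
      · exact fun n => ((continuous_lowPass R _).enorm.measurable.pow_const 2)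
      · intro n
        refine Eventually.of_forall fun x => (enorm_lowPass_sq_le R x _).trans ?_
        refine mul_le_mul_right ?_ _
        rw [sub_eq_add_neg]
        refine (enorm_add_sq_le _ _).trans ?_
        rw [enorm_neg]
        gcongr
        exact hv n
      · rw [setLIntegral_const]
        exact ENNReal.mul_ne_top (ENNReal.mul_ne_top measure_ball_lt_top.ne
          (ENNReal.add_ne_top.2 ⟨ENNReal.mul_ne_top (by norm_num) hC,
            ENNReal.mul_ne_top (by norm_num) (by simp)⟩)) hA
      · refine Eventually.of_forall fun x => ?_
        have hx : Tendsto (fun n => lowPass R x (v n)) atTop (𝓝 (lowPass R x u)) := by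
          have hre := h (Complex.reCLM.comp (lowPass R x))
          have him := h (Complex.imCLM.comp (lowPass R x))
          have := (Complex.continuous_ofReal.tendsto _).comp hre |>.add
            (((Complex.continuous_ofReal.tendsto _).comp him).mul_const Complex.I)
          simpa [Function.comp_def, Complex.re_add_im] using this
        have hx' : Tendsto (fun n => lowPass R x (v n - u)) atTop (𝓝 0) := by
          simp_rw [map_sub]
          simpa using hx.sub_const (lowPass R x u)
        have := ((continuous_enorm.tendsto _).comp hx')
        simpa using ENNReal.Tendsto.pow (n := 2) this
    have := ENNReal.Tendsto.const_mul (a := 2) h0 (Or.inr (by norm_num))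
    simpa using this
  filter_upwards [hlow.eventually (gt_mem_nhds (ENNReal.half_pos hε.ne'))] with n hn
  refine (setLIntegral_enorm_sq_le hs hR _ A).trans ?_
  rw [← ENNReal.add_halves ε]
  refine add_le_add hn.le (le_trans ?_ hRε)
  gcongr
  exact hd n

/-! ### The sublinear term -/

section Holder

variable {α : Type*} [MeasurableSpace α] {μ : Measure α} {ξ w d : α → ℝ} {p : ℝ}

theorem lintegral_sublinear_le (hp₁ : 1 < p) (hp₂ : p < 2) (hξ : AEStronglyMeasurable ξ μ)
    (hw : AEStronglyMeasurable w μ) (hd : AEStronglyMeasurable d μ) :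
    ∫⁻ x, ‖ξ x * |w x| ^ (p - 1) * d x‖ₑ ∂μ
      ≤ eLpNorm ξ (ENNReal.ofReal (2 / (2 - p))) μ * eLpNorm w 2 μ ^ (p - 1) * eLpNorm d 2 μ := by
  have h2p : 0 < 2 - p := by linarith
  have hp0 : 0 < p - 1 := by linarith
  have hq : 0 < 2 / (2 - p) := by positivity
  have hmeas : ∀ i ∈ (Finset.univ : Finset (Fin 3)), AEMeasurable ((![fun x => ‖ξ x‖ₑ ^ (2 / (2 - p)),
      fun x => ‖w x‖ₑ ^ (2 : ℝ), fun x => ‖d x‖ₑ ^ (2 : ℝ)] : Fin 3 → α → ℝ≥0∞) i) μ := by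
    intro i _
    fin_cases i
    · exact hξ.enorm.pow_const _
    · exact hw.enorm.pow_const _
    · exact hd.enorm.pow_const _
  have h := ENNReal.lintegral_prod_norm_pow_le Finset.univ hmeas
    (p := ![(2 - p) / 2, (p - 1) / 2, 1 / 2]) (by simp [Fin.sum_univ_three]; ring)
    (by
      intro i _
      fin_cases i
      · simp only [Fin.zero_eta, Matrix.cons_val_zero]; positivity
      · simp only [Fin.mk_one, Matrix.cons_val_one, Matrix.cons_val_zero]; positivity
      · simp)
  simp only [Fin.prod_univ_three, Matrix.cons_val_zero, Matrix.cons_val_one, Matrix.cons_val] at h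
  rw [eLpNorm_eq_lintegral_rpow_enorm_toReal (by simpa using hq) ENNReal.ofReal_ne_top,
    eLpNorm_eq_lintegral_rpow_enorm_toReal (by norm_num) (by norm_num),
    eLpNorm_eq_lintegral_rpow_enorm_toReal (by norm_num) (by norm_num),
    ENNReal.toReal_ofReal hq.le, ENNReal.toReal_ofNat, ← ENNReal.rpow_mul]
  convert! h using 1
  · refine lintegral_congr fun x => ?_
    rw [← ENNReal.rpow_mul, ← ENNReal.rpow_mul, ← ENNReal.rpow_mul, enorm_mul, enorm_mul]
    have h1 : 2 / (2 - p) * ((2 - p) / 2) = 1 := by field_simp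
    have h2 : 2 * ((p - 1) / 2) = p - 1 := by ring
    rw [h1, h2, ENNReal.rpow_one, Real.enorm_rpow_of_nonneg (abs_nonneg _) hp0.le, Real.enorm_abs]
    norm_num
  · have h1 : 1 / (2 / (2 - p)) = (2 - p) / 2 := by field_simp
    have h2 : 1 / 2 * (p - 1) = (p - 1) / 2 := by ring
    rw [h1, h2]

theorem integrable_sublinear (hp₁ : 1 < p) (hp₂ : p < 2)
    (hξ : MemLp ξ (ENNReal.ofReal (2 / (2 - p))) μ) (hw : MemLp w 2 μ) (hd : MemLp d 2 μ) :
    Integrable (fun x => ξ x * |w x| ^ (p - 1) * d x) μ := by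
  refine ⟨(hξ.1.mul (hw.1.aemeasurable.abs.pow_const _).aestronglyMeasurable).mul hd.1, ?_⟩
  refine (lintegral_sublinear_le hp₁ hp₂ hξ.1 hw.1 hd.1).trans_lt ?_
  exact ENNReal.mul_lt_top (ENNReal.mul_lt_top hξ.2
    (ENNReal.rpow_lt_top_of_nonneg (by linarith) hw.2.ne)) hd.2

end Holder

/-- Continuous nonlinearities `f` with `|f(x, t)| ≤ ξ(x) |t|^{p-1}`, `ξ ∈ L^{2/(2-p)}`. -/
structure IsSublinear (f : Space N → ℝ → ℝ) (p : ℝ) (ξ : Space N → ℝ) : Prop where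
  continuous : Continuous (Function.uncurry f)
  one_lt : 1 < p
  lt_two : p < 2
  memLp : MemLp ξ (ENNReal.ofReal (2 / (2 - p))) volume
  bound : ∀ᵐ x : Space N, ∀ t : ℝ, |f x t| ≤ ξ x * |t| ^ (p - 1)

namespace IsSublinear

variable {f : Space N → ℝ → ℝ} {p : ℝ} {ξ : Space N → ℝ}

theorem weight_nonneg (h : IsSublinear f p ξ) : ∀ᵐ x, 0 ≤ ξ x := by
  filter_upwards [h.bound] with x hx
  have := (abs_nonneg _).trans (hx 1)
  simpa using this

theorem continuous_primitive (h : IsSublinear f p ξ) :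
    Continuous (Function.uncurry (primitive f)) := by
  have h1 : Continuous (Function.uncurry fun (z : Space N × ℝ) (t : ℝ) => f z.1 t) :=
    h.continuous.comp (by fun_prop : Continuous fun z : (Space N × ℝ) × ℝ => (z.1.1, z.2))
  exact intervalIntegral.continuous_parametric_intervalIntegral_of_continuous h1 continuous_snd

theorem continuous_section (h : IsSublinear f p ξ) (x : Space N) : Continuous (f x) :=
  h.continuous.comp (by fun_prop : Continuous fun t : ℝ => (x, t))

theorem hasDerivAt_primitive (h : IsSublinear f p ξ) (x : Space N) (t : ℝ) :
    HasDerivAt (primitive f x) (f x t) t :=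
  intervalIntegral.integral_hasDerivAt_right ((h.continuous_section x).intervalIntegrable _ _)
    ((h.continuous_section x).stronglyMeasurableAtFilter _ _) (h.continuous_section x).continuousAt

theorem abs_primitive_sub_le (h : IsSublinear f p ξ) :
    ∀ᵐ x, ∀ a b : ℝ, |primitive f x a - primitive f x b|
      ≤ ξ x * |(|a| + |b|)| ^ (p - 1) * |a - b| := by
  filter_upwards [h.bound, h.weight_nonneg] with x hx hx0 a b
  have hi : ∀ c d, IntervalIntegrable (f x) volume c d := fun c d =>
    (h.continuous_section x).intervalIntegrable _ _
  rw [primitive, primitive, intervalIntegral.integral_interval_sub_left (hi _ _) (hi _ _),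
    ← Real.norm_eq_abs]
  refine intervalIntegral.norm_integral_le_of_norm_le_const fun t ht => (hx t).trans ?_
  have hp := h.one_lt
  rw [abs_of_nonneg (by positivity : 0 ≤ |a| + |b|)]
  refine mul_le_mul_of_nonneg_left (Real.rpow_le_rpow (abs_nonneg _) ?_ (by linarith)) hx0
  have ht' := Set.uIoc_subset_uIcc ht
  rw [Set.mem_uIcc] at ht'
  rcases ht' with ⟨h1, h2⟩ | ⟨h1, h2⟩ <;>
    refine abs_le.2 ⟨?_, ?_⟩ <;>
    linarith [neg_abs_le a, neg_abs_le b, le_abs_self a, le_abs_self b, abs_nonneg a, abs_nonneg b]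

theorem abs_primitive_le (h : IsSublinear f p ξ) :
    ∀ᵐ x, ∀ a : ℝ, |primitive f x a| ≤ ξ x * |a| ^ (p - 1) * |a| := by
  filter_upwards [h.abs_primitive_sub_le] with x hx a
  simpa [primitive] using hx a 0

theorem aestronglyMeasurable_primitive (h : IsSublinear f p ξ) {u : Space N → ℝ}
    (hu : AEStronglyMeasurable u volume) :
    AEStronglyMeasurable (fun x => primitive f x (u x)) volume :=
  h.continuous_primitive.comp_aestronglyMeasurable (aestronglyMeasurable_id.prodMk hu)

theorem aestronglyMeasurable_comp (h : IsSublinear f p ξ) {u : Space N → ℝ}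
    (hu : AEStronglyMeasurable u volume) :
    AEStronglyMeasurable (fun x => f x (u x)) volume :=
  h.continuous.comp_aestronglyMeasurable (aestronglyMeasurable_id.prodMk hu)

theorem integrable_primitive (h : IsSublinear f p ξ) {u : Space N → ℝ} (hu : MemLp u 2 volume) :
    Integrable (fun x => primitive f x (u x)) := by
  refine (integrable_sublinear h.one_lt h.lt_two h.memLp hu hu.abs).mono'
    (h.aestronglyMeasurable_primitive hu.1) ?_
  filter_upwards [h.abs_primitive_le] with x hx
  exact hx _

theorem integrable_mul (h : IsSublinear f p ξ) {u v : Space N → ℝ} (hu : MemLp u 2 volume)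
    (hv : MemLp v 2 volume) : Integrable (fun x => f x (u x) * v x) := by
  refine (integrable_sublinear h.one_lt h.lt_two h.memLp hu hv.abs).mono'
    ((h.aestronglyMeasurable_comp hu.1).mul hv.1) ?_
  filter_upwards [h.bound] with x hx
  rw [norm_mul]
  exact mul_le_mul_of_nonneg_right (hx _) (norm_nonneg _)

theorem enorm_integral_primitive_le (h : IsSublinear f p ξ) (u : L2 N) :
    ‖∫ x, primitive f x (u x)‖ₑ
      ≤ eLpNorm ξ (ENNReal.ofReal (2 / (2 - p))) volume * ‖u‖ₑ ^ p := by
  refine (enorm_integral_le_lintegral_enorm _).trans ?_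
  have h1 : ∫⁻ x, ‖primitive f x (u x)‖ₑ ≤ ∫⁻ x, ‖ξ x * |u x| ^ (p - 1) * u x‖ₑ := by
    refine lintegral_mono_ae ?_
    filter_upwards [h.abs_primitive_le, h.weight_nonneg] with x hx hx0
    rw [enorm_le_iff_norm_le, norm_mul,
      Real.norm_of_nonneg (mul_nonneg hx0 (Real.rpow_nonneg (abs_nonneg _) _))]
    exact hx _
  refine h1.trans ((lintegral_sublinear_le h.one_lt h.lt_two h.memLp.1 (Lp.aestronglyMeasurable u)
    (Lp.aestronglyMeasurable u)).trans (le_of_eq ?_))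
  rw [← Lp.enorm_def, mul_assoc]
  congr 1
  have : p = (p - 1) + 1 := by ring
  conv_rhs => rw [this, ENNReal.rpow_add_of_nonneg _ _ (by linarith [h.one_lt]) (by norm_num),
    ENNReal.rpow_one]

theorem hasDerivAt_integral_primitive (h : IsSublinear f p ξ) (u v : L2 N) :
    HasDerivAt (fun t : ℝ => ∫ x, primitive f x ((u + t • v) x)) (∫ x, f x (u x) * v x) 0 := by
  have hu := Lp.memLp u
  have hv := Lp.memLp v
  have hw : MemLp (fun x => |u x| + |v x|) 2 volume := hu.abs.add hv.abs
  have hp := h.one_lt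
  have key := hasDerivAt_integral_of_dominated_loc_of_deriv_le (μ := (volume : Measure (Space N)))
    (F := fun t x => primitive f x (u x + t * v x)) (x₀ := (0 : ℝ))
    (F' := fun t x => f x (u x + t * v x) * v x)
    (bound := fun x => ξ x * |(|u x| + |v x|)| ^ (p - 1) * |v x|) (Metric.ball_mem_nhds 0 one_pos)
    (Eventually.of_forall fun t =>
      h.aestronglyMeasurable_primitive (hu.1.add (hv.1.const_mul t)))
    (by simpa using h.integrable_primitive hu)
    (by simpa using (h.integrable_mul hu hv).1)
    (by
      filter_upwards [h.bound, h.weight_nonneg] with x hx hx0 t ht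
      rw [norm_mul]
      refine mul_le_mul_of_nonneg_right ((hx _).trans ?_) (norm_nonneg _)
      refine mul_le_mul_of_nonneg_left (Real.rpow_le_rpow (abs_nonneg _) ?_ (by linarith)) hx0
      rw [abs_of_nonneg (by positivity : 0 ≤ |u x| + |v x|)]
      refine (abs_add_le _ _).trans (add_le_add le_rfl ?_)
      rw [abs_mul]
      refine mul_le_of_le_one_left (abs_nonneg _) ?_
      simpa using (mem_ball_zero_iff.1 ht).le)
    (integrable_sublinear h.one_lt h.lt_two h.memLp hw hv.abs)
    (by
      refine Eventually.of_forall fun x t _ => ?_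
      have h1 : HasDerivAt (fun t : ℝ => u x + t * v x) (v x) t := by
        simpa using ((hasDerivAt_id t).mul_const (v x)).const_add (u x)
      exact (h.hasDerivAt_primitive x _).comp t h1)
  have h2 := key.2
  simp only [zero_mul, add_zero] at h2
  refine h2.congr_of_eventuallyEq (Eventually.of_forall fun t => ?_)
  refine integral_congr_ae ?_
  filter_upwards [Lp.coeFn_add u (t • v), Lp.coeFn_smul t v] with x h3 h4
  simp only [h3, Pi.add_apply, h4, Pi.smul_apply, smul_eq_mul]

theorem tendsto_integral_primitive (h : IsSublinear f p ξ) {u : L2 N} {v : ℕ → L2 N}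
    {C : ℝ≥0∞} (hC : C ≠ ⊤) (hvC : ∀ n, ‖v n‖ₑ ≤ C)
    (hloc : ∀ A : Set (Space N), volume A ≠ ⊤ →
      Tendsto (fun n => ∫⁻ x in A, ‖(v n - u) x‖ₑ ^ 2) atTop (𝓝 0)) :
    Tendsto (fun n => ∫ x, primitive f x (v n x)) atTop (𝓝 (∫ x, primitive f x (u x))) := by
  have hp := h.one_lt
  set q := ENNReal.ofReal (2 / (2 - p)) with hq
  set D := C + ‖u‖ₑ with hD
  have hDt : D ≠ ⊤ := ENNReal.add_ne_top.2 ⟨hC, enorm_ne_top⟩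
  have hDp : D ^ (p - 1) ≠ ⊤ := (ENNReal.rpow_lt_top_of_nonneg (by linarith) hDt).ne
  have hw : ∀ n, eLpNorm (fun x => |v n x| + |u x|) 2 volume ≤ D := by
    intro n
    refine (eLpNorm_add_le (Lp.memLp (v n)).abs.1 (Lp.memLp u).abs.1 (by norm_num)).trans ?_
    refine add_le_add ?_ ?_
    · refine le_trans (le_of_eq ?_) (hvC n)
      rw [Lp.enorm_def]
      exact eLpNorm_congr_norm_ae (Eventually.of_forall fun x => by simp)
    · refine le_of_eq ?_
      rw [Lp.enorm_def]
      exact eLpNorm_congr_norm_ae (Eventually.of_forall fun x => by simp)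
  have hd : ∀ n, eLpNorm (v n - u : L2 N) 2 volume ≤ D := by
    intro n
    rw [← Lp.enorm_def]
    refine le_trans (le_trans (le_of_eq ?_) (enorm_add_le (v n) (-u))) ?_
    · rw [sub_eq_add_neg]
    · rw [enorm_neg]
      exact add_le_add (hvC n) le_rfl
  have hmain : ∀ n, ‖(∫ x, primitive f x (v n x)) - ∫ x, primitive f x (u x)‖ₑ
      ≤ ∫⁻ x, ‖ξ x * |(|v n x| + |u x|)| ^ (p - 1) * (v n - u : L2 N) x‖ₑ := by
    intro n
    rw [← integral_sub (h.integrable_primitive (Lp.memLp _)) (h.integrable_primitive (Lp.memLp _))]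
    refine (enorm_integral_le_lintegral_enorm _).trans (lintegral_mono_ae ?_)
    filter_upwards [h.abs_primitive_sub_le, h.weight_nonneg, Lp.coeFn_sub (v n) u] with x hx hx0 hs
    rw [enorm_le_iff_norm_le, norm_mul,
      Real.norm_of_nonneg (mul_nonneg hx0 (Real.rpow_nonneg (abs_nonneg _) _)), hs]
    exact hx _ _
  rw [tendsto_iff_edist_tendsto_0]
  simp_rw [edist_eq_enorm_sub]
  rw [ENNReal.tendsto_nhds_zero]
  intro ε hε
  have hε2 := ENNReal.half_pos hε.ne'
  obtain ⟨A, hAm, hA, hAξ⟩ := h.memLp.exists_eLpNorm_indicator_compl_lt ENNReal.ofReal_ne_top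
    (ε := ε / 2 / (D ^ (p - 1) * D + 1))
    (ENNReal.div_ne_zero.2 ⟨hε2.ne', by finiteness⟩)
  have hloc' : Tendsto (fun n => eLpNorm ξ q volume * D ^ (p - 1)
      * eLpNorm (v n - u : L2 N) 2 (volume.restrict A)) atTop (𝓝 0) := by
    have h1 : Tendsto (fun n => eLpNorm (v n - u : L2 N) 2 (volume.restrict A)) atTop (𝓝 0) := by
      have h2 := (ENNReal.continuous_rpow_const (y := 1 / 2)).tendsto 0 |>.comp (hloc A hA.ne)
      rw [ENNReal.zero_rpow_of_pos (by norm_num)] at h2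
      refine h2.congr fun n => ?_
      rw [eLpNorm_eq_lintegral_rpow_enorm_toReal (by norm_num) (by norm_num)]
      simp
    have := ENNReal.Tendsto.const_mul h1 (a := eLpNorm ξ q volume * D ^ (p - 1))
      (Or.inr (ENNReal.mul_ne_top h.memLp.2.ne hDp))
    simpa using this
  filter_upwards [hloc'.eventually (gt_mem_nhds hε2)] with n hn
  refine (hmain n).trans ?_
  have hmw := ((Lp.memLp (v n)).abs.add (Lp.memLp u).abs).1
  rw [← lintegral_add_compl _ hAm, ← ENNReal.add_halves ε]
  refine add_le_add ?_ ?_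
  · refine (lintegral_sublinear_le h.one_lt h.lt_two h.memLp.1.restrict hmw.restrict
      (Lp.aestronglyMeasurable _).restrict).trans (le_trans ?_ hn.le)
    gcongr
    · exact Measure.restrict_le_self
    · exact (eLpNorm_restrict_le _ _ _ _).trans (hw n)
  · refine (lintegral_sublinear_le h.one_lt h.lt_two h.memLp.1.restrict hmw.restrict
      (Lp.aestronglyMeasurable _).restrict).trans ?_
    rw [← eLpNorm_indicator_eq_eLpNorm_restrict hAm.compl]
    calc _ ≤ (ε / 2 / (D ^ (p - 1) * D + 1)) * D ^ (p - 1) * D := by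
          gcongr
          · exact (eLpNorm_restrict_le _ _ _ _).trans (hw n)
          · exact (eLpNorm_restrict_le _ _ _ _).trans (hd n)
      _ ≤ (ε / 2 / (D ^ (p - 1) * D + 1)) * (D ^ (p - 1) * D + 1) := by
          rw [mul_assoc]
          gcongr
          exact le_self_add
      _ ≤ ε / 2 := (mul_comm _ _).trans_le ENNReal.mul_div_le

end IsSublinear

/-! ### The energy space and the energy -/

theorem memHs_iff {s : ℝ} {u : L2 N} : MemHs s u ↔ fracEnergy s u ≠ ⊤ := by
  rw [MemHs, MemLp, and_iff_right (aestronglyMeasurable_fourierHalfLap s u),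
    eLpNorm_lt_top_iff_lintegral_rpow_enorm_lt_top (by norm_num) (by norm_num), fracEnergy,
    ← lt_top_iff_ne_top]
  simp

theorem fracForm_self (s : ℝ) (u : L2 N) : fracForm s u u = (fracEnergy s u).toReal := by
  have h : ∀ ζ, (fourierHalfLap s u ζ * conj (fourierHalfLap s u ζ)).re
      = ‖fourierHalfLap s u ζ‖ ^ 2 := by
    intro ζ
    rw [Complex.mul_conj, Complex.ofReal_re, Complex.normSq_eq_norm_sq]
  simp only [fracForm, h]
  rw [integral_eq_lintegral_of_nonneg_ae (Eventually.of_forall fun ζ => sq_nonneg _)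
    ((aestronglyMeasurable_fourierHalfLap s u).norm.pow 2), fracEnergy]
  congr 1
  refine lintegral_congr fun ζ => ?_
  rw [ENNReal.ofReal_pow (norm_nonneg _), ofReal_norm]

theorem integral_add_const_mul_add_const_mul {α : Type*} [MeasurableSpace α] {μ : Measure α}
    {f g h : α → ℝ} (hf : Integrable f μ) (hg : Integrable g μ) (hh : Integrable h μ) (a b : ℝ) :
    ∫ x, (f x + a * g x + b * h x) ∂μ
      = (∫ x, f x ∂μ) + a * (∫ x, g x ∂μ) + b * ∫ x, h x ∂μ := by
  have h1 : Integrable (fun x => f x + a * g x) μ := hf.add (hg.const_mul a)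
  rw [integral_add h1 (hh.const_mul b),
    integral_add hf (hg.const_mul a), integral_const_mul, integral_const_mul]

section Potential

variable {V : Space N → ℝ}

theorem ofReal_mul_sq (hV0 : ∀ x, 0 ≤ V x) (u : L2 N) (x : Space N) :
    ENNReal.ofReal (V x * u x ^ 2) = ENNReal.ofReal (V x) * ‖u x‖ₑ ^ 2 := by
  rw [ENNReal.ofReal_mul (hV0 x), ← sq_abs, ENNReal.ofReal_pow (abs_nonneg _), ← Real.norm_eq_abs,
    ofReal_norm]

theorem aestronglyMeasurable_mul_sq (hV : Continuous V) (u : L2 N) :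
    AEStronglyMeasurable (fun x => V x * u x ^ 2) volume :=
  hV.aestronglyMeasurable.mul ((Lp.aestronglyMeasurable u).pow 2)

theorem integral_mul_sq (hV : Continuous V) (hV0 : ∀ x, 0 ≤ V x) (u : L2 N) :
    ∫ x, V x * u x ^ 2 = (∫⁻ x, ENNReal.ofReal (V x) * ‖u x‖ₑ ^ 2).toReal := by
  rw [integral_eq_lintegral_of_nonneg_ae
    (Eventually.of_forall fun x => mul_nonneg (hV0 x) (sq_nonneg _))
    (aestronglyMeasurable_mul_sq hV u)]
  simp_rw [ofReal_mul_sq hV0]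

theorem integrable_mul_sq_iff (hV : Continuous V) (hV0 : ∀ x, 0 ≤ V x) (u : L2 N) :
    Integrable (fun x => V x * u x ^ 2) ↔ ∫⁻ x, ENNReal.ofReal (V x) * ‖u x‖ₑ ^ 2 ≠ ⊤ := by
  rw [Integrable, and_iff_right (aestronglyMeasurable_mul_sq hV u),
    hasFiniteIntegral_iff_ofReal (Eventually.of_forall fun x => mul_nonneg (hV0 x) (sq_nonneg _)),
    lt_top_iff_ne_top]
  simp_rw [ofReal_mul_sq hV0]

theorem memEnergySpace_iff (hV : Continuous V) (hV0 : ∀ x, 0 ≤ V x) {s lam : ℝ} (hlam : 0 < lam)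
    {u : L2 N} : MemEnergySpace s V u ↔ quadEnergy s (fun x => lam * V x) u ≠ ⊤ := by
  rw [MemEnergySpace, quadEnergy, ENNReal.add_ne_top, memHs_iff,
    ← integrable_mul_sq_iff (hV.const_mul lam) (fun x => mul_nonneg hlam.le (hV0 x))]
  simp_rw [mul_assoc]
  rw [integrable_const_mul_iff hlam.ne'.isUnit]

theorem energy_eq (hV : Continuous V) (hV0 : ∀ x, 0 ≤ V x) {s lam : ℝ} (hlam : 0 < lam)
    (f : Space N → ℝ → ℝ) {u : L2 N} (hu : MemEnergySpace s V u) :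
    energy s V f lam u = (quadEnergy s (fun x => lam * V x) u).toReal / 2
      - ∫ x, primitive f x (u x) := by
  have h := (memEnergySpace_iff hV hV0 hlam).1 hu
  rw [quadEnergy, ENNReal.add_ne_top] at h
  rw [quadEnergy, ENNReal.toReal_add h.1 h.2, energy, fracForm_self,
    ← integral_mul_sq (hV.const_mul lam) (fun x => mul_nonneg hlam.le (hV0 x))]
  simp_rw [mul_assoc]
  rw [integral_const_mul]
  ring

theorem integrable_mul_mul (hV : Continuous V) (hV0 : ∀ x, 0 ≤ V x) {u v : L2 N}
    (hu : Integrable fun x => V x * u x ^ 2) (hv : Integrable fun x => V x * v x ^ 2) :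
    Integrable fun x => V x * u x * v x := by
  refine (hu.add hv).mono' ((hV.aestronglyMeasurable.mul (Lp.aestronglyMeasurable u)).mul
    (Lp.aestronglyMeasurable v)) (Eventually.of_forall fun x => ?_)
  rw [mul_assoc, norm_mul, Real.norm_of_nonneg (hV0 x), Real.norm_eq_abs, Pi.add_apply, ← mul_add]
  refine mul_le_mul_of_nonneg_left (abs_le.2 ⟨?_, ?_⟩) (hV0 x)
  · nlinarith [sq_nonneg (u x + v x), sq_nonneg (u x), sq_nonneg (v x)]
  · nlinarith [sq_nonneg (u x - v x), sq_nonneg (u x), sq_nonneg (v x)]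

theorem coeFn_add_smul (u v : L2 N) (t : ℝ) : ∀ᵐ x, (u + t • v) x = u x + t * v x := by
  filter_upwards [Lp.coeFn_add u (t • v), Lp.coeFn_smul t v] with x h1 h2
  rw [h1, Pi.add_apply, h2, Pi.smul_apply, smul_eq_mul]

theorem MemEnergySpace.add_smul (hV : Continuous V) (hV0 : ∀ x, 0 ≤ V x) {s : ℝ} {u v : L2 N}
    (hu : MemEnergySpace s V u) (hv : MemEnergySpace s V v) (t : ℝ) :
    MemEnergySpace s V (u + t • v) := by
  constructor
  · have h : MemLp (fourierHalfLap s u + t • fourierHalfLap s v) 2 volume :=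
      MemLp.add hu.1 (MemLp.const_smul hv.1 t)
    refine h.ae_eq ?_
    filter_upwards [fourierHalfLap_add s u (t • v), fourierHalfLap_smul s t v] with ζ h1 h2
    rw [h1, Pi.add_apply, Pi.add_apply, h2]
  · refine ((hu.2.add ((integrable_mul_mul hV hV0 hu.2 hv.2).const_mul (2 * t))).add
      (hv.2.const_mul (t ^ 2))).congr ?_
    filter_upwards [coeFn_add_smul u v t] with x hx
    simp only [hx, Pi.add_apply]
    ring

theorem integral_mul_sq_add_smul (hV : Continuous V) (hV0 : ∀ x, 0 ≤ V x) {s : ℝ} {u v : L2 N}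
    (hu : MemEnergySpace s V u) (hv : MemEnergySpace s V v) (t : ℝ) :
    ∫ x, V x * (u + t • v) x ^ 2 = (∫ x, V x * u x ^ 2) + 2 * t * (∫ x, V x * u x * v x)
      + t ^ 2 * ∫ x, V x * v x ^ 2 := by
  have huv := integrable_mul_mul hV hV0 hu.2 hv.2
  rw [← integral_add_const_mul_add_const_mul hu.2 huv hv.2]
  refine integral_congr_ae ?_
  filter_upwards [coeFn_add_smul u v t] with x hx
  simp only [hx]
  ring

end Potential

theorem integrable_fracForm {s : ℝ} {u v : L2 N} (hu : MemHs s u) (hv : MemHs s v) :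
    Integrable fun ζ => (fourierHalfLap s u ζ * conj (fourierHalfLap s v ζ)).re := by
  have h : MemLp (fun ζ => conj (fourierHalfLap s v ζ)) 2 volume := MemLp.star hv
  exact (MemLp.integrable_mul hu h).re

theorem fracForm_add_smul {s : ℝ} {u v : L2 N} (hu : MemHs s u) (hv : MemHs s v) (t : ℝ) :
    fracForm s (u + t • v) (u + t • v) = fracForm s u u + 2 * t * fracForm s u v
      + t ^ 2 * fracForm s v v := by
  have huu := integrable_fracForm hu hu
  have huv := integrable_fracForm hu hv
  have hvv := integrable_fracForm hv hv
  simp only [fracForm]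
  rw [← integral_add_const_mul_add_const_mul huu huv hvv]
  refine integral_congr_ae ?_
  filter_upwards [fourierHalfLap_add s u (t • v), fourierHalfLap_smul s t v] with ζ h1 h2
  rw [h1, Pi.add_apply, h2]
  simp
  ring

/-- Minimizers of the energy are weak solutions. -/
theorem isWeakSolution_of_forall_energy_le {V : Space N → ℝ} (hV : Continuous V)
    (hV0 : ∀ x, 0 ≤ V x) {f : Space N → ℝ → ℝ} {p : ℝ} {ξ : Space N → ℝ}
    (hf : IsSublinear f p ξ) {s lam : ℝ} {u : L2 N} (hu : MemEnergySpace s V u)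
    (hmin : ∀ v, MemEnergySpace s V v → energy s V f lam u ≤ energy s V f lam v) :
    IsWeakSolution s V f lam u := by
  refine ⟨hu, fun v hv => ⟨hf.integrable_mul (Lp.memLp u) (Lp.memLp v), ?_⟩⟩
  have hquad : ∀ a b c : ℝ, HasDerivAt (fun t : ℝ => a + 2 * t * b + t ^ 2 * c) (2 * b) 0 := by
    intro a b c
    have h1 := (((hasDerivAt_id (0 : ℝ)).const_mul 2).mul_const b).const_add a
    have h2 := ((hasDerivAt_id (0 : ℝ)).pow 2).mul_const c
    convert! h1.add h2 using 1
    simp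
  have hderiv : HasDerivAt (fun t : ℝ => energy s V f lam (u + t • v))
      (1 / 2 * (2 * fracForm s u v) + lam / 2 * (2 * ∫ x, V x * u x * v x)
        - ∫ x, f x (u x) * v x) 0 := by
    have h := (((hquad (fracForm s u u) (fracForm s u v) (fracForm s v v)).const_mul (1 / 2)).add
      ((hquad (∫ x, V x * u x ^ 2) (∫ x, V x * u x * v x) (∫ x, V x * v x ^ 2)).const_mul
        (lam / 2))).sub (hf.hasDerivAt_integral_primitive u v)
    refine h.congr_of_eventuallyEq (Eventually.of_forall fun t => ?_)
    simp only [energy, Pi.add_apply, Pi.sub_apply, fracForm_add_smul hu.1 hv.1,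
      integral_mul_sq_add_smul hV hV0 hu hv]
  have hloc : IsLocalMin (fun t : ℝ => energy s V f lam (u + t • v)) 0 := by
    refine Eventually.of_forall fun t => ?_
    simp only [zero_smul, add_zero]
    exact hmin _ (hu.add_smul hV hV0 hv t)
  have := hloc.hasDerivAt_eq_zero hderiv
  linarith

/-! ### Existence of a minimizer -/

theorem exists_mul_rpow_le {p : ℝ} (hp₁ : 0 < p) (hp₂ : p < 2) (C : ℝ) (hC : 0 ≤ C) :
    ∃ C₀ : ℝ, ∀ q : ℝ, 0 ≤ q → C * q ^ (p / 2) ≤ q / 4 + C₀ := by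
  have hlim : Tendsto (fun q : ℝ => q ^ (p / 2 - 1)) atTop (𝓝 0) := by
    have := tendsto_rpow_neg_atTop (y := 1 - p / 2) (by linarith)
    simpa using this
  have hev : ∀ᶠ q : ℝ in atTop, C * q ^ (p / 2 - 1) ≤ 1 / 4 := by
    have := hlim.const_mul C
    rw [mul_zero] at this
    exact this.eventually (ge_mem_nhds (by norm_num))
  obtain ⟨M, hM⟩ := eventually_atTop.1 hev
  set M' := max M 1
  refine ⟨C * M' ^ (p / 2), fun q hq => ?_⟩
  rcases le_total q M' with h | h
  · have : C * q ^ (p / 2) ≤ C * M' ^ (p / 2) := by gcongr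
    linarith
  · have hq0 : 0 < q := lt_of_lt_of_le one_pos ((le_max_right _ _).trans h)
    have h1 := hM q ((le_max_left _ _).trans h)
    have h2 : q ^ (p / 2) = q ^ (p / 2 - 1) * q := by
      rw [Real.rpow_sub_one hq0.ne', div_mul_cancel₀ _ hq0.ne']
    have h3 : 0 ≤ C * M' ^ (p / 2) := by positivity
    rw [h2, ← mul_assoc]
    nlinarith

theorem exists_forall_quadEnergy_sub_le {s : ℝ} (hs : 0 < s) {W : Space N → ℝ}
    (hW : Measurable W) (hW0 : ∀ x, 0 ≤ W x) {K : ℝ≥0∞} (hK : K ≠ ⊤)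
    (hcoer : ∀ u : L2 N, ‖u‖ₑ ^ 2 ≤ K * quadEnergy s W u)
    {f : Space N → ℝ → ℝ} {p : ℝ} {ξ : Space N → ℝ} (hf : IsSublinear f p ξ) :
    ∃ u : L2 N, quadEnergy s W u ≠ ⊤ ∧ ∀ v : L2 N, quadEnergy s W v ≠ ⊤ →
      (quadEnergy s W u).toReal / 2 - ∫ x, primitive f x (u x)
        ≤ (quadEnergy s W v).toReal / 2 - ∫ x, primitive f x (v x) := by
  have hp := hf.one_lt
  set Φ : L2 N → ℝ := fun u => ∫ x, primitive f x (u x) with hΦ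
  set J : L2 N → ℝ := fun u => (quadEnergy s W u).toReal / 2 - Φ u with hJ
  set c := eLpNorm ξ (ENNReal.ofReal (2 / (2 - p))) volume with hc
  have hct : c ≠ ⊤ := hf.memLp.2.ne
  have hKp : K ^ (p / 2) ≠ ⊤ := (ENNReal.rpow_lt_top_of_nonneg (by positivity) hK).ne
  obtain ⟨C₀, hC₀⟩ := exists_mul_rpow_le (by linarith) hf.lt_two
    (c * K ^ (p / 2)).toReal ENNReal.toReal_nonneg
  have hΦle : ∀ u, quadEnergy s W u ≠ ⊤ → |Φ u| ≤ (quadEnergy s W u).toReal / 4 + C₀ := by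
    intro u hu
    refine le_trans ?_ (hC₀ _ ENNReal.toReal_nonneg)
    have h1 : ‖Φ u‖ₑ ≤ c * K ^ (p / 2) * quadEnergy s W u ^ (p / 2) := by
      refine (hf.enorm_integral_primitive_le u).trans ?_
      rw [mul_assoc, ← ENNReal.mul_rpow_of_nonneg _ _ (by positivity)]
      gcongr
      have h2 : ‖u‖ₑ ^ p = (‖u‖ₑ ^ 2) ^ (p / 2) := by
        rw [← ENNReal.rpow_natCast, ← ENNReal.rpow_mul]
        congr 1
        push_cast
        ring
      rw [h2]
      exact ENNReal.rpow_le_rpow (hcoer u) (by positivity)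
    have h3 := ENNReal.toReal_mono (ENNReal.mul_ne_top (ENNReal.mul_ne_top hct hKp)
      (ENNReal.rpow_lt_top_of_nonneg (by positivity) hu).ne) h1
    rwa [toReal_enorm, Real.norm_eq_abs, ENNReal.toReal_mul, ← ENNReal.toReal_rpow] at h3
  set S : Set ℝ := J '' {u | quadEnergy s W u ≠ ⊤} with hS
  have hzero : quadEnergy s W (0 : L2 N) ≠ ⊤ := by
    have h1 : fracEnergy s (0 : L2 N) = 0 := by
      rw [fracEnergy, lintegral_eq_zero_iff'
        ((aestronglyMeasurable_fourierHalfLap s 0).enorm.pow_const 2)]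
      have := fourierHalfLap_smul s 0 (0 : L2 N)
      rw [zero_smul] at this
      filter_upwards [this] with ζ hζ
      rw [hζ]
      simp
    have h2 : ∫⁻ x, ENNReal.ofReal (W x) * ‖(0 : L2 N) x‖ₑ ^ 2 = 0 := by
      rw [← lintegral_zero (μ := (volume : Measure (Space N)))]
      exact lintegral_congr fun x => by simp
    rw [quadEnergy, h1, h2]
    simp
  have hlower : ∀ u, quadEnergy s W u ≠ ⊤ → (quadEnergy s W u).toReal / 4 - C₀ ≤ J u := by
    intro u hu
    have := (abs_le.1 (hΦle u hu)).2
    simp only [hJ]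
    linarith
  have hbdd : BddBelow S := by
    refine ⟨-C₀, ?_⟩
    rintro _ ⟨u, hu, rfl⟩
    have h1 := hlower u hu
    have h2 : 0 ≤ (quadEnergy s W u).toReal := ENNReal.toReal_nonneg
    linarith
  obtain ⟨a, -, ha, haS⟩ := exists_seq_tendsto_sInf (S := S) ⟨_, 0, hzero, rfl⟩ hbdd
  choose v hv hva using haS
  obtain ⟨B, hB⟩ := ha.bddAbove_range
  have hq : ∀ n, quadEnergy s W (v n) ≤ ENNReal.ofReal (4 * (B + C₀)) := by
    intro n
    rw [← ENNReal.ofReal_toReal (hv n)]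
    refine ENNReal.ofReal_le_ofReal ?_
    have h1 := hlower _ (hv n)
    rw [hva] at h1
    have h2 : a n ≤ B := hB ⟨n, rfl⟩
    linarith
  set M := ENNReal.ofReal (4 * (B + C₀)) with hM
  have hKM : K * M ≠ ⊤ := ENNReal.mul_ne_top hK ENNReal.ofReal_ne_top
  have hv2 : ∀ n, ‖v n‖ₑ ^ 2 ≤ K * M := fun n => (hcoer _).trans (by gcongr; exact hq n)
  have hv1 : ∀ n, ‖v n‖ₑ ≤ (K * M) ^ (1 / 2 : ℝ) := by
    intro n
    have := ENNReal.rpow_le_rpow (hv2 n) (by norm_num : (0 : ℝ) ≤ 1 / 2)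
    rw [← ENNReal.rpow_natCast, ← ENNReal.rpow_mul] at this
    simpa using this
  have hKM' : (K * M) ^ (1 / 2 : ℝ) ≠ ⊤ := (ENNReal.rpow_lt_top_of_nonneg (by norm_num) hKM).ne
  have : Fact ((2 : ℝ≥0∞) ≠ ⊤) := ⟨by norm_num⟩
  obtain ⟨u, φ, hφ, hweak⟩ := exists_subseq_tendsto_dual (u := v)
    (C := ((K * M) ^ (1 / 2 : ℝ)).toReal) (fun n => by
      rw [← toReal_enorm]
      exact ENNReal.toReal_mono hKM' (hv1 n))
  have hΦlim : Tendsto (fun n => Φ (v (φ n))) atTop (𝓝 (Φ u)) := by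
    refine hf.tendsto_integral_primitive hKM' (fun n => hv1 _) fun A hA => ?_
    exact tendsto_setLIntegral_sub_of_tendsto_dual hs hweak hKM (fun n => hv2 _)
      (M := M) ENNReal.ofReal_ne_top (fun n => le_self_add.trans (hq _)) hA
  have hQlim : Tendsto (fun n => (quadEnergy s W (v (φ n))).toReal) atTop
      (𝓝 (2 * (sInf S + Φ u))) := by
    have h1 := ((ha.comp hφ.tendsto_atTop).add hΦlim).const_mul 2
    refine h1.congr fun n => ?_
    simp only [Function.comp_apply, ← hva, hJ]
    ring
  have hQu : quadEnergy s W u ≤ ENNReal.ofReal (2 * (sInf S + Φ u)) := by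
    refine (quadEnergy_le_liminf s hW hW0 hweak).trans (le_of_eq ?_)
    refine Tendsto.liminf_eq ?_
    refine ((ENNReal.continuous_ofReal.tendsto _).comp hQlim).congr fun n => ?_
    exact ENNReal.ofReal_toReal (hv _)
  have h0 : 0 ≤ 2 * (sInf S + Φ u) := ge_of_tendsto' hQlim fun n => ENNReal.toReal_nonneg
  refine ⟨u, ne_top_of_le_ne_top ENNReal.ofReal_ne_top hQu, fun w hw => ?_⟩
  have h1 : sInf S ≤ J w := csInf_le hbdd ⟨w, hw, rfl⟩
  have h2 := ENNReal.toReal_mono ENNReal.ofReal_ne_top hQu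
  rw [ENNReal.toReal_ofReal h0] at h2
  simp only [hJ] at h1
  linarith

/-! ### Test functions of negative energy -/

theorem fracForm_smul (s c : ℝ) (u : L2 N) : fracForm s (c • u) (c • u) = c ^ 2 * fracForm s u u := by
  rw [fracForm, fracForm, ← integral_const_mul]
  refine integral_congr_ae ?_
  filter_upwards [fourierHalfLap_smul s c u] with ζ h
  rw [h]
  simp
  ring

theorem memHs_toLp_of_contDiff {s : ℝ} (hs₀ : 0 < s) (hs₁ : s < 1) {φ : Space N → ℝ}
    (hφ : ContDiff ℝ ∞ φ) (hφc : HasCompactSupport φ) (hm : MemLp φ 2 volume) :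
    MemHs s (hm.toLp φ) := by
  have hc₁ : HasCompactSupport (Complex.ofRealCLM ∘ φ) := hφc.comp_left rfl
  have hc₂ : ContDiff ℝ ∞ (Complex.ofRealCLM ∘ φ) := by fun_prop
  set ψ : SchwartzMap (Space N) ℂ := hc₁.toSchwartzMap hc₂ with hψ
  have h1 : Complex.ofRealCLM.compLp (hm.toLp φ) = ψ.toLp 2 := by
    ext1
    filter_upwards [Complex.ofRealCLM.coeFn_compLp (hm.toLp φ), hm.coeFn_toLp,
      ψ.coeFn_toLp 2] with x h1 h2 h3
    rw [h1, h2, h3]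
    rfl
  have h2 : fourierL2 (hm.toLp φ) = (𝓕 ψ).toLp 2 := by
    rw [fourierL2, h1, SchwartzMap.toLp_fourier_eq]
  have hg : Function.HasTemperateGrowth fun ζ : Space N => (1 + (2 * Real.pi) ^ 2 * ‖ζ‖ ^ 2 : ℝ) :=
    (Function.HasTemperateGrowth.const _).add
      ((Function.HasTemperateGrowth.const _).mul (Function.hasTemperateGrowth_norm_sq _))
  refine MemLp.of_le ((SchwartzMap.smulLeftCLM ℂ
    (fun ζ : Space N => (1 + (2 * Real.pi) ^ 2 * ‖ζ‖ ^ 2 : ℝ)) (𝓕 ψ)).memLp 2 volume)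
    (aestronglyMeasurable_fourierHalfLap s _) ?_
  filter_upwards [(𝓕 ψ).coeFn_toLp 2] with ζ hζ
  rw [SchwartzMap.smulLeftCLM_apply_apply hg, fourierHalfLap, h2, hζ, norm_mul, norm_smul,
    Complex.norm_real]
  refine mul_le_mul_of_nonneg_right ?_ (norm_nonneg _)
  set x := 2 * Real.pi * ‖ζ‖ with hx
  have hx0 : 0 ≤ x := by positivity
  rw [Real.norm_of_nonneg (by positivity), Real.norm_of_nonneg (by positivity), ← mul_pow, ← hx]
  rcases le_total x 1 with h | h
  · nlinarith [Real.rpow_le_one hx0 h hs₀.le, sq_nonneg x]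
  · have := Real.rpow_le_rpow_of_exponent_le h (by linarith : s ≤ 2)
    rw [Real.rpow_two] at this
    linarith

theorem le_primitive_of_pos {f : Space N → ℝ → ℝ}
    (hcont : Continuous (Function.uncurry (primitive f))) {B : Set (Space N)}
    (hB : IsPreconnected B) {η δ γ : ℝ} (hη : 0 < η)
    (hF : ∀ x ∈ B, ∀ t : ℝ, |t| ≤ δ → η * |t| ^ γ ≤ |primitive f x t|)
    {x₀ : Space N} (hx₀ : x₀ ∈ B) {t₀ : ℝ} (ht₀ : |t₀| ≤ δ) (hpos : 0 < primitive f x₀ t₀)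
    {x : Space N} (hx : x ∈ B) {θ : ℝ} (hθ : θ ∈ Set.Ioc (0 : ℝ) 1) :
    η * |θ * t₀| ^ γ ≤ primitive f x (θ * t₀) := by
  have ht0 : t₀ ≠ 0 := by
    rintro rfl
    simp [primitive] at hpos
  have hle : ∀ θ ∈ Set.Ioc (0 : ℝ) 1, |θ * t₀| ≤ δ := by
    intro θ hθ
    rw [abs_mul, abs_of_pos hθ.1]
    exact (mul_le_of_le_one_left (abs_nonneg _) hθ.2).trans ht₀
  have hne : ∀ z ∈ B ×ˢ Set.Ioc (0 : ℝ) 1, primitive f z.1 (z.2 * t₀) ≠ 0 := by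
    rintro ⟨y, τ⟩ ⟨hy, hτ⟩ h0
    have h1 := hF y hy (τ * t₀) (hle τ hτ)
    simp only at h0
    rw [h0, abs_zero] at h1
    have h2 : 0 < |τ * t₀| := abs_pos.2 (mul_ne_zero hτ.1.ne' ht0)
    have h3 : 0 < η * |τ * t₀| ^ γ := by positivity
    linarith
  have hg : Continuous fun z : Space N × ℝ => primitive f z.1 (z.2 * t₀) :=
    hcont.comp (by fun_prop : Continuous fun z : Space N × ℝ => (z.1, z.2 * t₀))
  have hconn : IsPreconnected (B ×ˢ Set.Ioc (0 : ℝ) 1) := hB.prod isPreconnected_Ioc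
  have hpos' : 0 < primitive f x (θ * t₀) := by
    by_contra hneg
    push Not at hneg
    obtain ⟨z, hz, hz0⟩ := hconn.intermediate_value (a := (x, θ)) (b := (x₀, 1)) ⟨hx, hθ⟩
      ⟨hx₀, by simp⟩ hg.continuousOn ⟨hneg, by simpa using hpos.le⟩
    exact hne z hz hz0
  have := hF x hx _ (hle θ hθ)
  rwa [abs_of_pos hpos'] at this

theorem exists_energy_neg {s : ℝ} (hs₀ : 0 < s) (hs₁ : s < 1) {V : Space N → ℝ}
    {f : Space N → ℝ → ℝ} {p : ℝ} {ξ : Space N → ℝ}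
    (hf : IsSublinear f p ξ) {η δ γ : ℝ} (hη : 0 < η) (hγ₂ : γ < 2)
    (hF : ∀ x ∈ well V, ∀ t : ℝ, |t| ≤ δ → η * |t| ^ γ ≤ |primitive f x t|)
    {x₀ : Space N} (hx₀ : x₀ ∈ well V) {t₀ : ℝ} (ht₀ : |t₀| ≤ δ)
    (hpos : 0 < primitive f x₀ t₀) (lam : ℝ) :
    ∃ u : L2 N, MemEnergySpace s V u ∧ energy s V f lam u < 0 := by
  have ht0 : t₀ ≠ 0 := by
    rintro rfl
    simp [primitive] at hpos
  have hopen : IsOpen (well V) := isOpen_interior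
  obtain ⟨r, hr, hrV⟩ := Metric.isOpen_iff.1 hopen x₀ hx₀
  have hlow : ∀ x ∈ Metric.ball x₀ r, ∀ θ ∈ Set.Ioc (0 : ℝ) 1,
      η * |θ * t₀| ^ γ ≤ primitive f x (θ * t₀) := fun x hx θ hθ =>
    le_primitive_of_pos hf.continuous_primitive (convex_ball x₀ r).isPreconnected hη
      (fun y hy => hF y (hrV hy)) (Metric.mem_ball_self hr) ht₀ hpos hx hθ
  let φ : ContDiffBump x₀ := ⟨r / 4, r / 2, by positivity, by linarith⟩
  have hφsupp : ∀ x, φ x ≠ 0 → x ∈ Metric.ball x₀ r := by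
    intro x hx
    have h1 : x ∈ Function.support φ := hx
    rw [φ.support_eq] at h1
    exact Metric.ball_subset_ball (by simp only [φ]; linarith) h1
  have hm : MemLp φ 2 volume := φ.continuous.memLp_of_hasCompactSupport φ.hasCompactSupport
  set u₀ : L2 N := hm.toLp φ
  have hHs : MemHs s u₀ := memHs_toLp_of_contDiff hs₀ hs₁ φ.contDiff φ.hasCompactSupport hm
  have hcoe : ∀ c : ℝ, ∀ᵐ x, (c • u₀) x = c * φ x := by
    intro c
    filter_upwards [Lp.coeFn_smul c u₀, hm.coeFn_toLp] with x h1 h2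
    rw [h1, Pi.smul_apply, h2, smul_eq_mul]
  have hV0 : ∀ c : ℝ, ∀ᵐ x, V x * (c • u₀) x ^ 2 = 0 := by
    intro c
    filter_upwards [hcoe c] with x hx
    rw [hx]
    by_cases h : φ x = 0
    · simp [h]
    · have hxV : x ∈ V ⁻¹' {0} := interior_subset (hrV (hφsupp x h))
      rw [show V x = 0 from hxV, zero_mul]
  have hmem : ∀ c : ℝ, MemEnergySpace s V (c • u₀) := by
    intro c
    constructor
    · refine (MemLp.const_smul hHs c).ae_eq ?_
      filter_upwards [fourierHalfLap_smul s c u₀] with ζ hζ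
      rw [hζ]
    · exact (integrable_zero _ _ _).congr ((hV0 c).mono fun x hx => hx.symm)
  set b := η * |t₀| ^ γ * volume.real (Metric.closedBall x₀ (r / 4)) with hb
  have hb0 : 0 < b := by
    have h1 : 0 < |t₀| := abs_pos.2 ht0
    have h2 : 0 < volume.real (Metric.closedBall x₀ (r / 4)) :=
      ENNReal.toReal_pos (Metric.measure_closedBall_pos volume x₀ (by positivity)).ne'
        measure_closedBall_lt_top.ne
    positivity
  have hΦ : ∀ τ ∈ Set.Ioc (0 : ℝ) 1,
      b * τ ^ γ ≤ ∫ x, primitive f x (((τ * t₀) • u₀ : L2 N) x) := by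
    intro τ hτ
    have h1 : b * τ ^ γ = ∫ x, (Metric.closedBall x₀ (r / 4)).indicator
        (fun _ => η * |τ * t₀| ^ γ) x := by
      rw [integral_indicator_const _ Metric.isClosed_closedBall.measurableSet, smul_eq_mul, abs_mul,
        abs_of_pos hτ.1, Real.mul_rpow hτ.1.le (abs_nonneg _)]
      ring
    rw [h1]
    refine integral_mono_ae ((integrable_indicator_iff
      Metric.isClosed_closedBall.measurableSet).2 (integrableOn_const measure_closedBall_lt_top.ne))
      (hf.integrable_primitive (Lp.memLp _)) ?_
    filter_upwards [hcoe (τ * t₀)] with x hx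
    simp only [hx]
    by_cases hxB : x ∈ Metric.closedBall x₀ (r / 4)
    · rw [Set.indicator_of_mem hxB, φ.one_of_mem_closedBall hxB, mul_one]
      exact hlow x (Metric.closedBall_subset_ball (by linarith) hxB) τ hτ
    · rw [Set.indicator_of_notMem hxB]
      by_cases h : φ x = 0
      · simp [h, primitive]
      · have hθ : τ * φ x ∈ Set.Ioc (0 : ℝ) 1 :=
          ⟨mul_pos hτ.1 (lt_of_le_of_ne φ.nonneg (Ne.symm h)), mul_le_one₀ hτ.2 φ.nonneg φ.le_one⟩
        have h2 := hlow x (hφsupp x h) _ hθ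
        rw [show τ * t₀ * φ x = τ * φ x * t₀ by ring]
        exact le_trans (by positivity) h2
  set a := 1 / 2 * (t₀ ^ 2 * fracForm s u₀ u₀) with ha
  obtain ⟨τ, hτ, hτa⟩ : ∃ τ ∈ Set.Ioc (0 : ℝ) 1, a * τ ^ (2 - γ) < b := by
    have hlim : Tendsto (fun τ : ℝ => a * τ ^ (2 - γ)) (𝓝[>] 0) (𝓝 0) := by
      have h1 := (Real.continuous_rpow_const (q := 2 - γ) (by linarith)).tendsto 0
      rw [Real.zero_rpow (by linarith)] at h1
      have h2 := (h1.mono_left (nhdsWithin_le_nhds (s := Set.Ioi 0))).const_mul a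
      rwa [mul_zero] at h2
    obtain ⟨τ, h1, h2⟩ := ((hlim.eventually (gt_mem_nhds hb0)).and
      (Ioc_mem_nhdsGT (zero_lt_one' ℝ))).exists
    exact ⟨τ, h2, h1⟩
  refine ⟨(τ * t₀) • u₀, hmem _, ?_⟩
  have hτγ : 0 < τ ^ γ := Real.rpow_pos_of_pos hτ.1 _
  have hsq : τ ^ 2 = τ ^ (2 - γ) * τ ^ γ := by
    rw [← Real.rpow_add hτ.1, sub_add_cancel, Real.rpow_two]
  have h1 := hΦ τ hτ
  rw [energy, fracForm_smul, integral_congr_ae (hV0 _), integral_zero]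
  have h2 : 1 / 2 * ((τ * t₀) ^ 2 * fracForm s u₀ u₀) = a * τ ^ (2 - γ) * τ ^ γ := by
    rw [mul_assoc a, ← hsq, ha]
    ring
  rw [h2]
  nlinarith [mul_lt_mul_of_pos_right hτa hτγ]

end FracSchrodinger

end

open FracSchrodinger in
theorem theorem1p1 (N : ℕ) (hN : 1 ≤ N) (s : ℝ) (hs₀ : 0 < s) (hs₁ : s < 1)
    (V : FracSchrodinger.Space N → ℝ) (hV : FracSchrodinger.IsSteepWell V)
    (f : FracSchrodinger.Space N → ℝ → ℝ) (hf : Continuous (Function.uncurry f))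
    (p : ℝ) (hp₁ : 1 < p) (hp₂ : p < 2)
    (ξ : FracSchrodinger.Space N → ℝ) (hξ : MemLp ξ (ENNReal.ofReal (2 / (2 - p))) volume)
    (hfξ : ∀ᵐ x : FracSchrodinger.Space N, ∀ t : ℝ, |f x t| ≤ ξ x * |t| ^ (p - 1))
    (η δ γ : ℝ) (hη : 0 < η) (hδ : 0 < δ) (hγ₁ : 1 < γ) (hγ₂ : γ < 2)
    (hF : ∀ x ∈ FracSchrodinger.well V, ∀ t : ℝ, |t| ≤ δ →
      η * |t| ^ γ ≤ |FracSchrodinger.primitive f x t|) :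
    ∃ Λ₀ : ℝ, 0 < Λ₀ ∧ ∀ lam : ℝ, Λ₀ < lam →
      ∃ u : FracSchrodinger.L2 N,
        FracSchrodinger.IsWeakSolution s V f lam u ∧
        (∀ v : FracSchrodinger.L2 N, FracSchrodinger.MemEnergySpace s V v →
          FracSchrodinger.energy s V f lam u ≤ FracSchrodinger.energy s V f lam v) ∧
        ((∃ x ∈ FracSchrodinger.well V, ∃ t : ℝ, |t| ≤ δ ∧ 0 < FracSchrodinger.primitive f x t) →
          FracSchrodinger.energy s V f lam u < 0 ∧ u ≠ 0) := by
  have hsub : IsSublinear f p ξ := ⟨hf, hp₁, hp₂, hξ, hfξ⟩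
  refine ⟨1, one_pos, fun lam hlam => ?_⟩
  have hlam0 : 0 < lam := by linarith
  have hVm := hV.continuous
  obtain ⟨b, hb, -, hvol⟩ := hV.sublevel
  have hWm : Measurable fun x => lam * V x := (hVm.const_mul lam).measurable
  obtain ⟨K, hK, hcoer⟩ := enorm_sq_le_mul_quadEnergy hN hs₀ hWm (mul_pos hlam0 hb)
    (by simpa only [mul_lt_mul_iff_right₀ hlam0] using hvol)
  obtain ⟨u, hu, hmin⟩ := exists_forall_quadEnergy_sub_le hs₀ hWm
    (fun x => mul_nonneg hlam0.le (hV.nonneg x)) hK hcoer hsub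
  have hE := fun v : L2 N => memEnergySpace_iff (u := v) (s := s) hVm hV.nonneg hlam0
  have hmin' : ∀ v, MemEnergySpace s V v → energy s V f lam u ≤ energy s V f lam v := by
    intro v hv
    rw [energy_eq hVm hV.nonneg hlam0 f ((hE u).2 hu), energy_eq hVm hV.nonneg hlam0 f hv]
    exact hmin v ((hE v).1 hv)
  refine ⟨u, isWeakSolution_of_forall_energy_le hVm hV.nonneg hsub ((hE u).2 hu) hmin', hmin', ?_⟩
  rintro ⟨x₀, hx₀, t₀, ht₀, hpos⟩
  obtain ⟨v, hv, hvneg⟩ := exists_energy_neg hs₀ hs₁ hsub hη hγ₂ hF hx₀ ht₀ hpos lam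
  have hneg := (hmin' v hv).trans_lt hvneg
  refine ⟨hneg, ?_⟩
  rintro rfl
  have h1 := fracForm_smul s 0 (0 : L2 N)
  rw [zero_smul, zero_pow two_ne_zero, zero_mul] at h1
  rw [energy, h1] at hneg
  simp [primitive] at hneg
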